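/- **Setting.** All vector spaces are over $\mathbb C$. Let $n\ge 2$, $A_n=\mathbb C[t_1,\dots,t_n]$, $d_i=\partial/\partial t_i$, and let $W_n=\mathrm{Der}(A_n)$. Let $S_n=\{\sum g_id_i:\sum d_i(g_i)=0\}$, and, for $n=2m$, let $H_n$ be the algebra of $D\in W_n$ annihilating the 2-form $\sum_{i=1}^m dt_i\wedge dt_{m+i}$. Put $d_{ij}(f)=d_j(f)d_i-d_i(f)d_j$ and $d_H(f)=\sum_{j=1}^m d_j(f)d_{m+j}-\sum_{j=m+1}^{2m}d_j(f)d_{j-m}$. Let $X_n$ be one of $W_n$, $S_n$, $H_n$ (with $n=2m$ in the last case). Let $\mathfrak g$ be a finite-dimensional simple Lie algebra, and let $\mathcal Z=\bigoplus_{j=1}^n A_nK_j$. Let $$\mathfrak L=\mathfrak L(\mathfrak g,X_n)=\big((\mathfrak g\otimes A_n)\oplus\mathcal Z\big)\rtimes X_n ,$$ where $[x\otimes f,y\otimes h]=[x,y]\otimes fh$, $\mathcal Z$ commutes with $(\mathfrak g\otimes A_n)\oplus\mathcal Z$, and $[D,x\otimes f]=x\otimes D(f)$, $[D,fK_j]=D(f)K_j$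 for $D\in X_n$. It is $\mathbb Z$-graded: $x\otimes f$ and $fK_j$ have degree $\deg f$, and $\sum_j g_jd_j$ with all $g_j$ homogeneous of degree $i+1$ has degree $i$. Write $\mathfrak L_i$ for the graded components, $\mathfrak L_{\ge k}=\bigoplus_{i\ge k}\mathfrak L_i$, and $(X_n)_0$ for the linear vector fields in $X_n$; thus $\mathfrak L_0=\mathfrak g\oplus(X_n)_0\oplus\mathrm{span}\{K_1,\dots,K_n\}$. **$(A_n,\mathfrak L)$-modules.** An $(A_n,\mathfrak L)$-module is an $A_n$-module $M$ together with a representation $\rho$ of $\mathfrak L$ and a representation $\sigma$ of $\mathfrak L_{\ge0}$ on $M$ (as a complex vector space) such that, for all $f\in A_n$, $x\in\mathfrak g$, $1\le i,j\le n$ and $D'\in\mathfrak L_{\ge0}$: 1. $[\rho(Y),f]=Y(f)$ for $Y\in X_n$, and $[\rho(z),f]=0$ for $z\in(\mathfrak g\otimes A_n)\oplus\mathcal Z$; 2. $[\sigma(D'),f]=0$; 3. $[\rho(d_i),\sigma(D')]=0$; 4. $\rho(x\otimes f)=\sigma(x)\circ f$ and $\rho(fK_j)=\sigma(K_j)\circ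 f$; 5. if $X_n=W_n$: $\rho(fd_j)=f\rho(d_j)+\sum_i (d_if)\,\sigma(t_id_j)$; if $X_n=S_n$: $\rho(d_{ij}(f))=(d_jf)\rho(d_i)-(d_if)\rho(d_j)+\sum_{|\alpha|=2}\frac{1}{\alpha!}(d^\alpha f)\,\sigma(d_{ij}(t^\alpha))$ for $i<j$; if $X_n=H_n$: $\rho(d_H(f))=\sum_{j=1}^m(d_jf)\rho(d_{m+j})-\sum_{j=m+1}^{2m}(d_jf)\rho(d_{j-m})+\sum_{|\alpha|=2}\frac1{\alpha!}(d^\alpha f)\,\sigma(d_H(t^\alpha))$. A $\rho$-submodule is a subspace stable under $\rho(\mathfrak L)$. An $(A_n,\mathfrak L)$-submodule is a subspace stable under $A_n$, $\rho(\mathfrak L)$ and $\sigma(\mathfrak L_{\ge0})$. **Exceptional modules.** Let $n_X=n,\ n-1,\ m$ for $X_n=W_n,S_n,H_n$. The Cartan subalgebra $\mathfrak h_X$ of $(X_n)_0$ consists of the diagonal fields $\sum_i c_it_id_i$ in $X_n$. Let $\mathfrak n_X^+$ be spanned by the $t_id_j$ with $i<j$ for $W_n,S_n$, and by the $t_id_j-t_{j+m}d_{i+m}$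 with $i<j\le m$ and the $t_sd_{k+m}+t_kd_{s+m}$ with $k\le s\le m$ for $H_n$. For $0\le k\le n_X$ let $\mu_k\in\mathfrak h_X^*$ be given by $\mu_k(\sum_i c_it_id_i)=c_1+\dots+c_k$. Then $L^0_X(0,\mu_k,\mathbf 0)$ denotes the irreducible $\mathfrak L_0$-module on which $\mathfrak g$ and all $K_j$ act by $0$ and which has highest weight $\mu_k$ for $(X_n)_0$, with respect to $\mathfrak h_X\oplus\mathfrak n_X^+$. **Theorem.** Let $M$ be an $(A_n,\mathfrak L(\mathfrak g,X_n))$-module such that $\sigma(\mathfrak L_{\ge1})=0$, such that $M$ is completely reducible as an $\mathfrak L_0$-module via $\sigma|_{\mathfrak L_0}$, and such that no irreducible component of this $\mathfrak L_0$-module is isomorphic to $L^0_X(0,\mu_k,\mathbf 0)$ for any $0\le k\le n_X$. Then every $\rho$-submodule $M'$ of $M$ is an $(A_n,\mathfrak L(\mathfrak g,X_n))$-submodule. -/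

import Mathlib

open scoped TensorProduct

noncomputable section

namespace PolyToroidal

/-- The polynomial algebra `A_n = ℂ[t_1, …, t_n]`. -/
abbrev Poly (n : ℕ) : Type := MvPolynomial (Fin n) ℂ

/-- The Witt algebra `W_n` of all derivations of `A_n`, with the commutator bracket. -/
abbrev Witt (n : ℕ) : Type := Derivation ℂ (Poly n) (Poly n)

/-- The coordinate function `t_i`. -/
abbrev t {n : ℕ} (i : Fin n) : Poly n := MvPolynomial.X i

/-- The partial derivative `d_i = ∂/∂t_i`, as an element of `W_n`. -/
abbrev d {n : ℕ} (i : Fin n) : Witt n := MvPolynomial.pderiv i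

/-- The three series of Lie algebras of polynomial vector fields in `n` variables. For the
Hamiltonian series the number of variables has to be even, and half of it is recorded. -/
inductive Series (n : ℕ) : Type where
  | W : Series n
  | S : Series n
  | H (m : ℕ) (hm : n = 2 * m) : Series n

/-! ### Auxiliary facts on derivations of the polynomial algebra -/

lemma witt_sum_apply {n : ℕ} {ι : Type*} (s : Finset ι) (D : ι → Witt n) (f : Poly n) :
    (∑ i ∈ s, D i) f = ∑ i ∈ s, D i f := by
  classical
  induction s using Finset.induction_on with
  | empty => simp
  | insert a s ha ih => rw [Finset.sum_insert ha, Finset.sum_insert ha, Derivation.add_apply, ih]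

lemma witt_apply {n : ℕ} (D : Witt n) (f : Poly n) : D f = ∑ j, D (t j) * d j f := by
  have h : D = ∑ j, D (t j) • d j := by
    apply MvPolynomial.derivation_ext
    intro i
    rw [witt_sum_apply]
    simp [MvPolynomial.pderiv_X, Pi.single_apply]
  conv_lhs => rw [h]
  rw [witt_sum_apply]
  simp

lemma d_comm {n : ℕ} (i j : Fin n) (f : Poly n) : d i (d j f) = d j (d i f) := by
  have h : ⁅d i, d j⁆ = (0 : Witt n) := by
    apply MvPolynomial.derivation_ext
    intro k
    rw [Derivation.commutator_apply]
    simp only [MvPolynomial.pderiv_X, Pi.single_apply]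
    split_ifs <;> simp
  have h2 := congrArg (fun D : Witt n => D f) h
  simp only [Derivation.commutator_apply, Derivation.coe_zero, Pi.zero_apply] at h2
  exact sub_eq_zero.mp h2

lemma d_witt {n : ℕ} (i : Fin n) (D : Witt n) (f : Poly n) :
    d i (D f) = D (d i f) + ∑ k, d i (D (t k)) * d k f := by
  rw [witt_apply D f, witt_apply D (d i f), map_sum, ← Finset.sum_add_distrib]
  refine Finset.sum_congr rfl fun k _ => ?_
  rw [Derivation.leibniz, d_comm i k f]
  simp only [smul_eq_mul]
  ring

/-! ### Divergence-free and Hamiltonian vector fields -/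

/-- The divergence `∑ d_i(g_i)` of the vector field `∑ g_i d_i`. -/
def divergence {n : ℕ} (D : Witt n) : Poly n := ∑ i, d i (D (t i))

lemma divergence_lie {n : ℕ} (D E : Witt n) :
    divergence ⁅D, E⁆ = D (divergence E) - E (divergence D) := by
  simp only [divergence, map_sum, Derivation.commutator_apply, map_sub, d_witt _ D (E _),
    d_witt _ E (D _), Finset.sum_sub_distrib, Finset.sum_add_distrib]
  rw [Finset.sum_comm (f := fun i k => d i (D (t k)) * d k (E (t i)))]
  have : ∀ i k : Fin n, d k (D (t i)) * d i (E (t k)) = d i (E (t k)) * d k (D (t i)) :=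
    fun i k => mul_comm _ _
  simp only [this]
  have e1 : ∀ i : Fin n, D (d i (E (t i))) = d i (D (E (t i))) - ∑ k, d i (D (t k)) * d k (E (t i)) :=
    fun i => by rw [d_witt i D]; ring
  ring

/-- The special algebra `S_n`: polynomial vector fields of divergence zero. -/
def specialAlgebra (n : ℕ) : LieSubalgebra ℂ (Witt n) where
  carrier := {D | divergence D = 0}
  add_mem' {D E} hD hE := by
    simp only [Set.mem_ofPred_eq, divergence] at *
    simp [Finset.sum_add_distrib, hD, hE]
  zero_mem' := by simp [divergence]
  smul_mem' c D hD := by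
    simp only [Set.mem_ofPred_eq, divergence] at *
    simp [← Finset.smul_sum, hD]
  lie_mem' {D E} hD hE := by
    change divergence D = 0 at hD
    change divergence E = 0 at hE
    change divergence ⁅D, E⁆ = 0
    rw [divergence_lie, hD, hE]; simp

/-- The values `J a b = ω(d_a, d_b)` of the symplectic form
`ω = ∑_{i ≤ m} dt_i ∧ dt_{m+i}` on the coordinate vector fields of `ℂ^{2m}`. -/
def sympl {n : ℕ} (m : ℕ) (a b : Fin n) : ℂ :=
  if (b : ℕ) = a + m then 1 else if (a : ℕ) = b + m then -1 else 0

/-- The value on `(d_a, d_b)` of the Lie derivative `L_D ω` of the symplectic form `ω`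
along `D = ∑ g_c d_c`. -/
def lieDerivSympl {n : ℕ} (m : ℕ) (D : Witt n) (a b : Fin n) : Poly n :=
  ∑ c, (sympl m c b • d a (D (t c)) + sympl m a c • d b (D (t c)))

lemma lieDerivSympl_lie {n : ℕ} (m : ℕ) (D E : Witt n) (a b : Fin n) :
    lieDerivSympl m ⁅D, E⁆ a b =
      D (lieDerivSympl m E a b) - E (lieDerivSympl m D a b)
      + ∑ k, (d a (D (t k)) * lieDerivSympl m E k b + d b (D (t k)) * lieDerivSympl m E a k
        - d a (E (t k)) * lieDerivSympl m D k b - d b (E (t k)) * lieDerivSympl m D a k) := by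
  have cross : ∀ P Q : Fin n → Poly n,
      ∑ k, ∑ c, P k * (sympl m k c • Q c) = ∑ k, ∑ c, Q k * (sympl m c k • P c) := by
    intro P Q
    rw [Finset.sum_comm]
    refine Finset.sum_congr rfl fun k _ => Finset.sum_congr rfl fun c _ => ?_
    simp only [MvPolynomial.smul_eq_C_mul]; ring
  have c1 := cross (fun k => d a (D (t k))) (fun k => d b (E (t k)))
  have c2 := cross (fun k => d a (E (t k))) (fun k => d b (D (t k)))
  have s1 : ∀ P : Fin n → Poly n, ∀ Q : Fin n → Fin n → Poly n, ∀ x : Fin n → ℂ,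
      ∑ k, ∑ c, P k * (x c • Q k c) = ∑ c, x c • ∑ k, P k * Q k c := by
    intro P Q x
    rw [Finset.sum_comm]
    refine Finset.sum_congr rfl fun c _ => ?_
    rw [Finset.smul_sum]
    refine Finset.sum_congr rfl fun k _ => ?_
    simp only [MvPolynomial.smul_eq_C_mul]; ring
  simp only [lieDerivSympl, Derivation.commutator_apply, map_sub, d_witt _ D (E _),
    d_witt _ E (D _), map_sum, map_add, Derivation.map_smul, Finset.mul_sum, mul_add, smul_sub,
    smul_add, Finset.sum_sub_distrib, Finset.sum_add_distrib, s1] at c1 c2 ⊢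
  rw [c1, c2]
  ring

/-- The Hamiltonian algebra `H_n`, `n = 2m`: polynomial vector fields `D` with `L_D ω = 0`. -/
def hamiltonianAlgebra (n m : ℕ) : LieSubalgebra ℂ (Witt n) where
  carrier := {D | ∀ a b, lieDerivSympl m D a b = 0}
  add_mem' {D E} hD hE a b := by
    have h1 := hD a b
    have h2 := hE a b
    have : lieDerivSympl m (D + E) a b = lieDerivSympl m D a b + lieDerivSympl m E a b := by
      simp only [lieDerivSympl, Derivation.add_apply, map_add, smul_add, Finset.sum_add_distrib]
      ring
    rw [this, h1, h2, add_zero]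
  zero_mem' a b := by simp [lieDerivSympl]
  smul_mem' c D hD a b := by
    have h1 := hD a b
    have : lieDerivSympl m (c • D) a b = c • lieDerivSympl m D a b := by
      simp only [lieDerivSympl, Derivation.smul_apply, Derivation.map_smul, Finset.smul_sum,
        smul_add, smul_comm c]
    rw [this, h1, smul_zero]
  lie_mem' {D E} hD hE a b := by
    change ∀ a b, lieDerivSympl m D a b = 0 at hD
    change ∀ a b, lieDerivSympl m E a b = 0 at hE
    rw [lieDerivSympl_lie]
    simp [hD, hE]

/-- The Lie algebra `X_n`, that is `W_n`, `S_n` or `H_n`, as a subalgebra of `W_n`. -/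
def vectorFields {n : ℕ} : Series n → LieSubalgebra ℂ (Witt n)
  | .W => ⊤
  | .S => specialAlgebra n
  | .H m _ => hamiltonianAlgebra n m

/-- `d_{ij}(f) = d_j(f) d_i - d_i(f) d_j`. -/
def dS {n : ℕ} (i j : Fin n) (f : Poly n) : Witt n := d j f • d i - d i f • d j

/-- `d_H(f) = ∑_{a ≤ m} d_a(f) d_{a+m} - ∑_{a > m} d_a(f) d_{a-m}`, written through the values
`J a b` of the symplectic form. -/
def dH {n : ℕ} (m : ℕ) (f : Poly n) : Witt n := ∑ a, ∑ b, (sympl m a b • d a f) • d b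

lemma d_mem {n : ℕ} (X : Series n) (i : Fin n) : d i ∈ vectorFields X := by
  have h : ∀ a k : Fin n, d a (d i (t k)) = 0 := by
    intro a k
    simp only [MvPolynomial.pderiv_X, Pi.single_apply]
    split_ifs <;> simp
  cases X with
  | W => exact LieSubalgebra.mem_top _
  | S => change divergence _ = 0; simp only [divergence, h, Finset.sum_const_zero]
  | H m hm => intro a b; simp only [lieDerivSympl, h, smul_zero, add_zero, Finset.sum_const_zero]

lemma dS_apply_t {n : ℕ} (i j k : Fin n) (f : Poly n) :
    dS i j f (t k) = (if k = i then d j f else 0) - (if k = j then d i f else 0) := by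
  simp [dS, MvPolynomial.pderiv_X, Pi.single_apply, eq_comm]

lemma dS_mem {n : ℕ} (i j : Fin n) (f : Poly n) : dS i j f ∈ vectorFields (.S : Series n) := by
  change divergence _ = 0
  simp only [divergence, dS_apply_t, map_sub, Finset.sum_sub_distrib, apply_ite (d _), map_zero]
  simp [d_comm i j f]

lemma dH_apply_t {n : ℕ} (m : ℕ) (k : Fin n) (f : Poly n) :
    dH m f (t k) = ∑ a, sympl m a k • d a f := by
  simp only [dH, witt_sum_apply]
  refine Finset.sum_congr rfl fun a _ => ?_
  simp [MvPolynomial.pderiv_X, Pi.single_apply]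

lemma sympl_swap {n : ℕ} {m : ℕ} (hm : n = 2 * m) (a b : Fin n) :
    sympl m b a = - sympl m a b := by
  have := a.2
  have := b.2
  simp only [sympl]
  split_ifs <;> first | omega | simp

lemma sympl_sq {n : ℕ} {m : ℕ} (hm : n = 2 * m) (a b : Fin n) :
    ∑ c, sympl m a c * sympl m c b = if a = b then -1 else 0 := by
  have ha := a.2
  have hb := b.2
  by_cases h : (a : ℕ) < m
  · rw [Finset.sum_eq_single (⟨a + m, by omega⟩ : Fin n)]
    · simp only [sympl, Fin.ext_iff]
      split_ifs <;> first | omega | simp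
    · intro c _ hc
      have : (c : ℕ) ≠ a + m := fun h => hc (Fin.ext h)
      have : sympl m a c = 0 := by
        simp only [sympl]; split_ifs <;> first | omega | rfl
      rw [this, zero_mul]
    · simp
  · rw [Finset.sum_eq_single (⟨a - m, by omega⟩ : Fin n)]
    · simp only [sympl, Fin.ext_iff]
      split_ifs <;> first | omega | simp
    · intro c _ hc
      have : (c : ℕ) ≠ a - m := fun h => hc (Fin.ext h)
      have hc2 := c.2
      have : sympl m a c = 0 := by
        simp only [sympl]; split_ifs <;> first | omega | rfl
      rw [this, zero_mul]
    · simp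

lemma dH_mem {n m : ℕ} (hm : n = 2 * m) (f : Poly n) : dH m f ∈ vectorFields (.H m hm) := by
  intro a b
  have key : ∀ P : Fin n → Poly n, ∀ b : Fin n,
      ∑ c, ∑ k, sympl m c b • sympl m k c • P k = - P b := by
    intro P b
    rw [Finset.sum_comm]
    have : ∀ k, ∑ c, sympl m c b • sympl m k c • P k = (if k = b then -1 else 0 : ℂ) • P k := by
      intro k
      rw [← sympl_sq hm k b, Finset.sum_smul]
      exact Finset.sum_congr rfl fun c _ => by rw [smul_smul, mul_comm]
    simp [this]
  simp only [lieDerivSympl, dH_apply_t, map_sum, Derivation.map_smul, Finset.smul_sum,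
    Finset.sum_add_distrib, key]
  have e : ∀ c k : Fin n, sympl m a c • sympl m k c • d b (d k f)
      = - (sympl m c a • sympl m k c • d b (d k f)) := by
    intro c k
    rw [sympl_swap hm c a, neg_smul]
  simp only [e, Finset.sum_neg_distrib, key, d_comm b a f]
  ring

/-! ### The polynomial toroidal Lie algebra and its subalgebras -/

/-- The Lie algebra `𝔤 ⊗ A` over `ℂ`, for a commutative algebra `A`, with the bracket
`[x ⊗ f, y ⊗ h] = [x, y] ⊗ f h`. -/
def CurrentAlgebra (A g : Type*) [CommRing A] [Algebra ℂ A] [LieRing g] [LieAlgebra ℂ g] :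
    Type _ := A ⊗[ℂ] g

namespace CurrentAlgebra

variable {A g : Type*} [CommRing A] [Algebra ℂ A] [LieRing g] [LieAlgebra ℂ g]

instance : LieRing (CurrentAlgebra A g) := LieAlgebra.ExtendScalars.instLieRing ℂ A g

instance : LieAlgebra ℂ (CurrentAlgebra A g) := LieAlgebra.ExtendScalars.instBaseLieAlgebra ℂ A g

/-- The element `x ⊗ f`. -/
def mk (f : A) (x : g) : CurrentAlgebra A g := f ⊗ₜ[ℂ] x

lemma lie_mk (f h : A) (x y : g) : ⁅mk f x, mk h y⁆ = mk (f * h) ⁅x, y⁆ := rfl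

lemma mk_neg (f : A) (x : g) : mk f (-x) = -mk f x := TensorProduct.tmul_neg _ _

lemma mk_add (f h : A) (x : g) : mk (f + h) x = mk f x + mk h x := TensorProduct.add_tmul _ _ _

lemma mk_sub (f h : A) (x : g) : mk (f - h) x = mk f x - mk h x := TensorProduct.sub_tmul _ _ _

lemma induction {P : CurrentAlgebra A g → Prop} (a : CurrentAlgebra A g) (zero : P 0)
    (tmul : ∀ f x, P (mk f x)) (add : ∀ a b, P a → P b → P (a + b)) : P a :=
  TensorProduct.induction_on a zero tmul add

/-- The linear map `x ⊗ f ↦ x ⊗ D(f)`. -/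
def der (D : Derivation ℂ A A) : CurrentAlgebra A g →ₗ[ℂ] CurrentAlgebra A g :=
  LinearMap.rTensor g (D : A →ₗ[ℂ] A)

lemma der_mk (D : Derivation ℂ A A) (f : A) (x : g) : der D (mk f x) = mk (D f) x := rfl

lemma der_lie (D : Derivation ℂ A A) (a b : CurrentAlgebra A g) :
    der D ⁅a, b⁆ = ⁅a, der D b⁆ - ⁅b, der D a⁆ := by
  induction a using CurrentAlgebra.induction with
  | zero => simp
  | add a₁ a₂ h₁ h₂ => simp only [add_lie, map_add, h₁, h₂, lie_add]; abel
  | tmul f x =>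
    induction b using CurrentAlgebra.induction with
    | zero => simp
    | add b₁ b₂ h₁ h₂ => simp only [lie_add, map_add, h₁, h₂, add_lie]; abel
    | tmul h y =>
      simp only [lie_mk, der_mk, Derivation.leibniz, smul_eq_mul, mk_add]
      rw [← lie_skew x y, mk_neg, mk_neg, sub_eq_add_neg]

lemma der_commutator (D E : Derivation ℂ A A) (a : CurrentAlgebra A g) :
    der ⁅D, E⁆ a = der D (der E a) - der E (der D a) := by
  induction a using CurrentAlgebra.induction with
  | zero => simp
  | add a₁ a₂ h₁ h₂ => simp only [map_add, h₁, h₂]; abel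
  | tmul f x => simp only [der_mk, Derivation.commutator_apply, mk_sub]

lemma der_add (D E : Derivation ℂ A A) (a : CurrentAlgebra A g) :
    der (D + E) a = der D a + der E a := by
  induction a using CurrentAlgebra.induction with
  | zero => simp
  | add a₁ a₂ h₁ h₂ => simp only [map_add, h₁, h₂]; abel
  | tmul f x => simp only [der_mk, Derivation.add_apply, mk_add]

lemma der_smul (c : ℂ) (D : Derivation ℂ A A) (a : CurrentAlgebra A g) :
    der (c • D) a = c • der D a := by
  induction a using CurrentAlgebra.induction with
  | zero => simp
  | add a₁ a₂ h₁ h₂ => simp only [map_add, h₁, h₂, smul_add]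
  | tmul f x => exact TensorProduct.smul_tmul' c (D f) x

end CurrentAlgebra

/-- The space `𝒵 = span {t^r K_j : r ∈ ℕ^n, 1 ≤ j ≤ n} = A_n K_1 ⊕ ⋯ ⊕ A_n K_n`; the `j`-th
entry of a tuple is the coefficient of `K_j`. -/
def Central (n : ℕ) : Type := Fin n → Poly n

instance (n : ℕ) : AddCommGroup (Central n) := inferInstanceAs (AddCommGroup (Fin n → Poly n))

instance (n : ℕ) : Module ℂ (Central n) := inferInstanceAs (Module ℂ (Fin n → Poly n))

/-- `𝒵` is an abelian Lie algebra. -/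
instance (n : ℕ) : LieRing (Central n) where
  bracket _ _ := 0
  add_lie _ _ _ := (add_zero _).symm
  lie_add _ _ _ := (add_zero _).symm
  lie_self _ := rfl
  leibniz_lie _ _ _ := (add_zero _).symm

instance (n : ℕ) : LieAlgebra ℂ (Central n) where
  lie_smul c _ _ := (smul_zero c).symm

/-- The element `f K_j` of `𝒵`. -/
def Central.mk {n : ℕ} (f : Poly n) (j : Fin n) : Central n := (Pi.single j f : Fin n → Poly n)

/-- The trivial central extension `(𝔤 ⊗ A_n) ⊕ 𝒵`. -/
abbrev Current (n : ℕ) (g : Type*) [LieRing g] [LieAlgebra ℂ g] : Type _ :=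
  CurrentAlgebra (Poly n) g × Central n

section Toroidal

variable {n : ℕ} {g : Type*} [LieRing g] [LieAlgebra ℂ g]

/-- A vector field `D` acts on `(𝔤 ⊗ A_n) ⊕ 𝒵` by `D(x ⊗ f) = x ⊗ D(f)`, `D(f K_j) = D(f) K_j`. -/
def currentMap (D : Witt n) : Current n g →ₗ[ℂ] Current n g :=
  LinearMap.prodMap (CurrentAlgebra.der D)
    (LinearMap.pi (φ := fun _ : Fin n => Poly n) fun j =>
      (D : Poly n →ₗ[ℂ] Poly n) ∘ₗ LinearMap.proj j : Central n →ₗ[ℂ] Central n)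

variable (n g) in
/-- The action of `W_n` on `(𝔤 ⊗ A_n) ⊕ 𝒵` by derivations. -/
def wittAction : Witt n →ₗ⁅ℂ⁆ LieDerivation ℂ (Current n g) (Current n g) where
  toFun D :=
    { currentMap D with
      leibniz' := by
        rintro ⟨a, z⟩ ⟨b, w⟩
        refine Prod.ext (CurrentAlgebra.der_lie D a b) ?_
        funext j
        change D 0 = (0 : Poly n) - 0
        simp }
  map_add' D E := by
    ext1 ⟨a, z⟩
    exact Prod.ext (CurrentAlgebra.der_add D E a) rfl
  map_smul' c D := by
    ext1 ⟨a, z⟩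
    exact Prod.ext (CurrentAlgebra.der_smul c D a) rfl
  map_lie' {D E} := by
    ext1 ⟨a, z⟩
    rw [LieDerivation.lie_apply]
    refine Prod.ext (CurrentAlgebra.der_commutator D E a) ?_
    funext j
    exact Derivation.commutator_apply (D1 := D) (D2 := E) (z j)

end Toroidal

/-- The Lie algebra `𝔏(𝔤, X_n) = ((𝔤 ⊗ A_n) ⊕ 𝒵) ⋊ X_n`. -/
abbrev Toroidal {n : ℕ} (g : Type*) [LieRing g] [LieAlgebra ℂ g] (X : Series n) : Type _ :=
  LieAlgebra.SemiDirectSum (Current n g) (vectorFields X)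
    ((wittAction n g).comp (vectorFields X).incl)

section Grading

variable {n : ℕ} (g : Type*) [LieRing g] [LieAlgebra ℂ g] (X : Series n)

/-- The element `x ⊗ f` of `𝔏(𝔤, X_n)`. -/
def ofCurrent {g : Type*} [LieRing g] [LieAlgebra ℂ g] (f : Poly n) (x : g) : Toroidal g X :=
  ⟨(CurrentAlgebra.mk f x, 0), 0⟩

/-- The element `f K_j` of `𝔏(𝔤, X_n)`. -/
def ofCentral (f : Poly n) (j : Fin n) : Toroidal g X := ⟨(0, Central.mk f j), 0⟩

/-- A vector field in `X_n` as an element of `𝔏(𝔤, X_n)`. -/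
def ofField {X : Series n} (D : Witt n) (hD : D ∈ vectorFields X) : Toroidal g X := ⟨0, ⟨D, hD⟩⟩

/-- The span of the `x ⊗ f` with `f` homogeneous of degree `k`. -/
def currentGrade (n : ℕ) (g : Type*) [LieRing g] [LieAlgebra ℂ g] (k : ℕ) :
    Submodule ℂ (CurrentAlgebra (Poly n) g) :=
  Submodule.span ℂ {u | ∃ (f : Poly n) (x : g), f.IsHomogeneous k ∧ u = CurrentAlgebra.mk f x}

/-- The graded component `𝔏(𝔤, X_n)_k` for `k ≥ 0`: the elements whose `𝔤 ⊗ A_n`-part and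
whose coefficients of the `K_j` are homogeneous of degree `k`, and whose vector field has
coefficients homogeneous of degree `k + 1`. -/
def grade (k : ℕ) : Submodule ℂ (Toroidal g X) where
  carrier := {y | y.left.1 ∈ currentGrade n g k ∧ (∀ j, (y.left.2 j).IsHomogeneous k) ∧
    ∀ j, ((y.right : Witt n) (t j)).IsHomogeneous (k + 1)}
  add_mem' hy hz :=
    ⟨Submodule.add_mem _ hy.1 hz.1, fun j => (hy.2.1 j).add (hz.2.1 j),
      fun j => (hy.2.2 j).add (hz.2.2 j)⟩
  zero_mem' := ⟨Submodule.zero_mem _, fun _ => MvPolynomial.isHomogeneous_zero _ _ _,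
    fun _ => MvPolynomial.isHomogeneous_zero _ _ _⟩
  smul_mem' c _ hy :=
    ⟨Submodule.smul_mem _ c hy.1,
      fun j => (MvPolynomial.homogeneousSubmodule (Fin n) ℂ k).smul_mem c (hy.2.1 j),
      fun j => (MvPolynomial.homogeneousSubmodule (Fin n) ℂ (k + 1)).smul_mem c (hy.2.2 j)⟩

variable {g X}

lemma witt_homogeneous {k l : ℕ} {D : Witt n} (hD : ∀ j, (D (t j)).IsHomogeneous (k + 1))
    {f : Poly n} (hf : f.IsHomogeneous l) : (D f).IsHomogeneous (k + l) := by
  rw [witt_apply]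
  refine MvPolynomial.IsHomogeneous.sum _ _ _ fun j _ => ?_
  rcases l with _ | l
  · rw [(MvPolynomial.totalDegree_eq_zero_iff_eq_C.mp
      ((MvPolynomial.totalDegree_zero_iff_isHomogeneous _).mpr hf))]
    simp [MvPolynomial.isHomogeneous_zero]
  · have h := (hD j).mul (hf.pderiv (i := j))
    have e : k + 1 + (l + 1 - 1) = k + (l + 1) := by omega
    rwa [e] at h

lemma currentGrade_lie {k l : ℕ} {a b : CurrentAlgebra (Poly n) g} (ha : a ∈ currentGrade n g k)
    (hb : b ∈ currentGrade n g l) : ⁅a, b⁆ ∈ currentGrade n g (k + l) := by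
  induction ha using Submodule.span_induction with
  | zero => simp
  | add x y _ _ hx hy => rw [add_lie]; exact Submodule.add_mem _ hx hy
  | smul c x _ hx => rw [smul_lie]; exact Submodule.smul_mem _ c hx
  | mem x hx =>
    obtain ⟨f, u, hf, rfl⟩ := hx
    induction hb using Submodule.span_induction with
    | zero => simp
    | add x y _ _ hx hy => rw [lie_add]; exact Submodule.add_mem _ hx hy
    | smul c x _ hx => rw [lie_smul]; exact Submodule.smul_mem _ c hx
    | mem x hx =>
      obtain ⟨h, v, hh, rfl⟩ := hx
      exact Submodule.subset_span ⟨f * h, ⁅u, v⁆, hf.mul hh, rfl⟩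

lemma currentGrade_witt {k l : ℕ} {D : Witt n} (hD : ∀ j, (D (t j)).IsHomogeneous (k + 1))
    {a : CurrentAlgebra (Poly n) g} (ha : a ∈ currentGrade n g l) :
    CurrentAlgebra.der D a ∈ currentGrade n g (k + l) := by
  induction ha using Submodule.span_induction with
  | zero => simp
  | add x y _ _ hx hy => rw [map_add]; exact Submodule.add_mem _ hx hy
  | smul c x _ hx => rw [map_smul]; exact Submodule.smul_mem _ c hx
  | mem x hx =>
    obtain ⟨f, u, hf, rfl⟩ := hx
    exact Submodule.subset_span ⟨D f, u, witt_homogeneous hD hf, rfl⟩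

lemma grade_lie {k l : ℕ} {y z : Toroidal g X} (hy : y ∈ grade g X k) (hz : z ∈ grade g X l) :
    ⁅y, z⁆ ∈ grade g X (k + l) := by
  obtain ⟨hy1, hy2, hy3⟩ := hy
  obtain ⟨hz1, hz2, hz3⟩ := hz
  refine ⟨?_, fun j => ?_, fun j => ?_⟩
  · refine Submodule.sub_mem _ (Submodule.add_mem _ (currentGrade_lie hy1 hz1)
      (currentGrade_witt hy3 hz1)) ?_
    rw [add_comm k l]
    exact currentGrade_witt hz3 hy1
  · have h1 := witt_homogeneous hy3 (hz2 j)
    have h2 := witt_homogeneous hz3 (hy2 j)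
    rw [add_comm l k] at h2
    have h3 := (MvPolynomial.homogeneousSubmodule (Fin n) ℂ (k + l)).sub_mem h1 h2
    change (0 + (y.right : Witt n) (z.left.2 j)
      - (z.right : Witt n) (y.left.2 j)).IsHomogeneous (k + l)
    rw [zero_add]
    exact h3
  · have h1 := witt_homogeneous hy3 (hz3 j)
    have h2 := witt_homogeneous hz3 (hy3 j)
    rw [show l + (k + 1) = k + (l + 1) by omega] at h2
    exact (MvPolynomial.homogeneousSubmodule (Fin n) ℂ (k + (l + 1))).sub_mem h1 h2

variable (g X)

/-- `𝔏(𝔤, X_n)_{≥ k}`, the sum of the graded components of degree at least `k`, for `k ≥ 0`. -/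
def filtration (k : ℕ) : Submodule ℂ (Toroidal g X) := ⨆ i : ℕ, ⨆ _ : k ≤ i, grade g X i

variable {g X} in
lemma grade_le_filtration {k i : ℕ} (h : k ≤ i) : grade g X i ≤ filtration g X k :=
  le_iSup₂_of_le i h le_rfl

/-- The Lie subalgebra `𝔏(𝔤, X_n)_{≥ 0}`. -/
def geZero : LieSubalgebra ℂ (Toroidal g X) where
  toSubmodule := filtration g X 0
  lie_mem' {y z} hy hz := by
    change y ∈ filtration g X 0 at hy
    change z ∈ filtration g X 0 at hz
    change ⁅y, z⁆ ∈ filtration g X 0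
    unfold filtration at hy hz
    induction hy using Submodule.iSup_induction' with
    | zero => rw [zero_lie]; exact Submodule.zero_mem _
    | add a b _ _ ha hb => rw [add_lie]; exact Submodule.add_mem _ ha hb
    | mem i a ha =>
      simp only [Nat.zero_le, iSup_pos] at ha
      induction hz using Submodule.iSup_induction' with
      | zero => rw [lie_zero]; exact Submodule.zero_mem _
      | add a b _ _ ha hb => rw [lie_add]; exact Submodule.add_mem _ ha hb
      | mem j b hb =>
        simp only [Nat.zero_le, iSup_pos] at hb
        exact grade_le_filtration (Nat.zero_le _) (grade_lie ha hb)

/-- The Lie subalgebra `𝔏(𝔤, X_n)_0 = 𝔤 ⊕ (X_n)_0 ⊕ span {K_1, …, K_n}`. -/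
def degZero : LieSubalgebra ℂ (Toroidal g X) where
  toSubmodule := grade g X 0
  lie_mem' {y z} hy hz := by
    have h := grade_lie (k := 0) (l := 0) (y := y) (z := z) hy hz
    rwa [Nat.add_zero] at h

lemma degZero_le_geZero : degZero g X ≤ geZero g X := fun _ hy =>
  grade_le_filtration (Nat.zero_le 0) hy

variable {X}

/-- The element `x = x ⊗ 1` of `𝔏(𝔤, X_n)_{≥ 0}`. -/
def geZeroOfLie (X : Series n) {g : Type*} [LieRing g] [LieAlgebra ℂ g] (x : g) : geZero g X :=
  ⟨ofCurrent X 1 x, degZero_le_geZero g X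
    ⟨Submodule.subset_span ⟨1, x, MvPolynomial.isHomogeneous_one _ _, rfl⟩,
      fun _ => MvPolynomial.isHomogeneous_zero _ _ _,
      fun _ => MvPolynomial.isHomogeneous_zero _ _ _⟩⟩

/-- The element `K_j` of `𝔏(𝔤, X_n)_{≥ 0}`. -/
def geZeroK (X : Series n) (j : Fin n) : geZero g X :=
  ⟨ofCentral g X 1 j, degZero_le_geZero g X
    ⟨Submodule.zero_mem _, fun i => by
      by_cases h : i = j
      · subst h; simp [ofCentral, Central.mk, MvPolynomial.isHomogeneous_one]
      · simp [ofCentral, Central.mk, h, MvPolynomial.isHomogeneous_zero],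
      fun _ => MvPolynomial.isHomogeneous_zero _ _ _⟩⟩

/-- A linear vector field in `X_n` as an element of `𝔏(𝔤, X_n)_{≥ 0}`. -/
def geZeroOfField (D : Witt n) (hD : D ∈ vectorFields X)
    (hlin : ∀ j, (D (t j)).IsHomogeneous 1) : geZero g X :=
  ⟨ofField g D hD, degZero_le_geZero g X
    ⟨Submodule.zero_mem _, fun _ => MvPolynomial.isHomogeneous_zero _ _ _, hlin⟩⟩

lemma linear_W (i j k : Fin n) : ((t i • d j : Witt n) (t k)).IsHomogeneous 1 := by
  simp only [Derivation.smul_apply, MvPolynomial.pderiv_X, Pi.single_apply, smul_eq_mul]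
  split_ifs
  · rw [mul_one]; exact MvPolynomial.isHomogeneous_X _ _
  · rw [mul_zero]; exact MvPolynomial.isHomogeneous_zero _ _ _

lemma d_quadratic (a b k : Fin n) : (d k (t a * t b)).IsHomogeneous 1 :=
  ((MvPolynomial.isHomogeneous_X ℂ a).mul (MvPolynomial.isHomogeneous_X ℂ b)).pderiv

lemma linear_S (i j a b k : Fin n) : (dS i j (t a * t b) (t k)).IsHomogeneous 1 := by
  rw [dS_apply_t]
  refine (MvPolynomial.homogeneousSubmodule (Fin n) ℂ 1).sub_mem ?_ ?_
  · split_ifs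
    · exact d_quadratic a b j
    · exact Submodule.zero_mem _
  · split_ifs
    · exact d_quadratic a b i
    · exact Submodule.zero_mem _

lemma linear_H (m : ℕ) (a b k : Fin n) : (dH m (t a * t b) (t k)).IsHomogeneous 1 := by
  rw [dH_apply_t]
  exact Submodule.sum_mem (MvPolynomial.homogeneousSubmodule (Fin n) ℂ 1) fun c _ =>
    Submodule.smul_mem _ _ (d_quadratic a b c)

/-- `t_i d_j` as an element of `𝔏(𝔤, W_n)_{≥ 0}`. -/
def linW (i j : Fin n) : geZero g (.W : Series n) :=
  geZeroOfField g (t i • d j) (LieSubalgebra.mem_top _) (linear_W i j)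

/-- `d_{ij}(t_a t_b)` as an element of `𝔏(𝔤, S_n)_{≥ 0}`. -/
def linS (i j a b : Fin n) : geZero g (.S : Series n) :=
  geZeroOfField g (dS i j (t a * t b)) (dS_mem i j _) (linear_S i j a b)

/-- `d_H(t_a t_b)` as an element of `𝔏(𝔤, H_n)_{≥ 0}`. -/
def linH (m : ℕ) (hm : n = 2 * m) (a b : Fin n) : geZero g (.H m hm : Series n) :=
  geZeroOfField g (dH m (t a * t b)) (dH_mem hm _) (linear_H m a b)

end Grading

/-! ### `(A_n, 𝔏(𝔤, X_n))`-modules -/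

attribute [local instance] LieRing.ofAssociativeRing

section Modules

variable {n : ℕ} (g : Type*) [LieRing g] [LieAlgebra ℂ g]
  (M : Type*) [AddCommGroup M] [Module ℂ M] [Module (Poly n) M]

variable {M} in
/-- The compatibility of the action `ρ` of the vector fields with the action `σ` of the linear
vector fields:

* for `W_n`: `ρ(f d_j) = f ρ(d_j) + ∑_i (d_i f) σ(t_i d_j)`;
* for `S_n`: `ρ(d_{ij}(f)) = (d_j f) ρ(d_i) - (d_i f) ρ(d_j)
  + ∑_{|α| = 2} (d^α f / α!) σ(d_{ij}(t^α))` for `i < j`;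
* for `H_n`: `ρ(d_H(f)) = ∑_{a ≤ m} (d_a f) ρ(d_{a+m}) - ∑_{a > m} (d_a f) ρ(d_{a-m})
  + ∑_{|α| = 2} (d^α f / α!) σ(d_H(t^α))`.

The sum over the multi-indices `α` with `|α| = 2` is written as one half of the sum over all ordered
pairs `(a, b)`: `α = e_a + e_b` with `a ≠ b` occurs twice and has `α! = 1`, and `α = 2 e_a` occurs
once and has `α! = 2`. -/
def VectorFieldCompat : (X : Series n) → (Toroidal g X →ₗ⁅ℂ⁆ Module.End ℂ M) →
    (geZero g X →ₗ⁅ℂ⁆ Module.End ℂ M) → Prop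
  | .W, ρ, σ => ∀ (f : Poly n) (j : Fin n) (v : M),
      ρ (ofField g (f • d j) (LieSubalgebra.mem_top _)) v
        = f • ρ (ofField g (d j) (d_mem _ j)) v + ∑ i, d i f • σ (linW g i j) v
  | .S, ρ, σ => ∀ (f : Poly n) (i j : Fin n) (v : M), i < j →
      ρ (ofField g (dS i j f) (dS_mem i j f)) v
        = d j f • ρ (ofField g (d i) (d_mem _ i)) v - d i f • ρ (ofField g (d j) (d_mem _ j)) v
          + (1 / 2 : ℂ) • ∑ a, ∑ b, d a (d b f) • σ (linS g i j a b) v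
  | .H m hm, ρ, σ => ∀ (f : Poly n) (v : M),
      ρ (ofField g (dH m f) (dH_mem hm f)) v
        = ∑ a, ∑ b, (sympl m a b • d a f) • ρ (ofField g (d b) (d_mem _ b)) v
          + (1 / 2 : ℂ) • ∑ a, ∑ b, d a (d b f) • σ (linH g m hm a b) v

/-- The structure of an `(A_n, 𝔏(𝔤, X_n))`-module on an `A_n`-module `M`: a representation `ρ` of
`𝔏(𝔤, X_n)` and a representation `σ` of `𝔏(𝔤, X_n)_{≥ 0}` with the following compatibilities. -/
structure ToroidalModule (X : Series n) where
  /-- the `𝔏(𝔤, X_n)`-module structure -/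
  ρ : Toroidal g X →ₗ⁅ℂ⁆ Module.End ℂ M
  /-- the `𝔏(𝔤, X_n)_{≥ 0}`-module structure -/
  σ : geZero g X →ₗ⁅ℂ⁆ Module.End ℂ M
  /-- `[ρ(Y), f] = Y(f)` for `Y ∈ X_n` -/
  ρ_field : ∀ (Y : Witt n) (hY : Y ∈ vectorFields X) (f : Poly n) (v : M),
    ρ (ofField g Y hY) (f • v) = f • ρ (ofField g Y hY) v + Y f • v
  /-- `[ρ(x), f] = 0` for `x ∈ (𝔤 ⊗ A_n) ⊕ 𝒵` -/
  ρ_current : ∀ (x : Current n g) (f : Poly n) (v : M),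
    ρ ⟨x, 0⟩ (f • v) = f • ρ ⟨x, 0⟩ v
  /-- `[σ(y), f] = 0` -/
  σ_smul : ∀ (y : geZero g X) (f : Poly n) (v : M), σ y (f • v) = f • σ y v
  /-- `[ρ(d_i), σ(y)] = 0` -/
  ρ_d_σ : ∀ (i : Fin n) (y : geZero g X) (v : M),
    ρ (ofField g (d i) (d_mem X i)) (σ y v) = σ y (ρ (ofField g (d i) (d_mem X i)) v)
  /-- the formula for `ρ` on vector fields -/
  compat : VectorFieldCompat g X ρ σ
  /-- `ρ(x ⊗ f) = σ(x) ∘ f` for `x ∈ 𝔤` -/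
  ρ_lie : ∀ (x : g) (f : Poly n) (v : M), ρ (ofCurrent X f x) v = σ (geZeroOfLie X x) (f • v)
  /-- `ρ(f K_j) = σ(K_j) ∘ f` -/
  ρ_K : ∀ (j : Fin n) (f : Poly n) (v : M), ρ (ofCentral g X f j) v = σ (geZeroK g X j) (f • v)

end Modules

/-! ### Lie representations as Lie modules -/

/-- The space `V` of a representation `φ` of a Lie algebra, regarded as a Lie module through `φ`. -/
def RepSpace {L V : Type*} [LieRing L] [LieAlgebra ℂ L] [AddCommGroup V] [Module ℂ V]
    (_ : L →ₗ⁅ℂ⁆ Module.End ℂ V) : Type _ := V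

section RepSpace

variable {L V : Type*} [LieRing L] [LieAlgebra ℂ L] [AddCommGroup V] [Module ℂ V]
  (φ : L →ₗ⁅ℂ⁆ Module.End ℂ V)

instance : AddCommGroup (RepSpace φ) := inferInstanceAs (AddCommGroup V)

instance : Module ℂ (RepSpace φ) := inferInstanceAs (Module ℂ V)

instance : LieRingModule L (RepSpace φ) := LieRingModule.compLieHom V φ

instance : LieModule ℂ L (RepSpace φ) := LieModule.compLieHom V φ

lemma repSpace_lie (x : L) (v : V) :
    (⁅x, (show RepSpace φ from v)⁆ : RepSpace φ) = (show RepSpace φ from φ x v) := rfl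

end RepSpace

/-! ### The exceptional irreducible modules of the degree zero part -/

/-- `n_X`, which is `n`, `n - 1`, `m` for `W_n`, `S_n`, `H_n`. -/
def rankX {n : ℕ} : Series n → ℕ
  | .W => n
  | .S => n - 1
  | .H m _ => m

/-- The standard spanning set of `𝔫⁺_X`: for `W_n` and `S_n` the `t_i d_j` with `i < j`; for `H_n`
the `t_i d_j - t_{j+m} d_{i+m}` with `i < j ≤ m` and the `t_i d_{j+m} + t_j d_{i+m}` with
`j ≤ i ≤ m`. Here `i' = i + m` and `j' = j + m`. -/
def positiveRootVectors {n : ℕ} : Series n → Set (Witt n)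
  | .W => {D | ∃ i j : Fin n, i < j ∧ D = t i • d j}
  | .S => {D | ∃ i j : Fin n, i < j ∧ D = t i • d j}
  | .H m _ => {D | ∃ i j i' j' : Fin n, (i' : ℕ) = i + m ∧ (j' : ℕ) = j + m ∧
      ((i < j ∧ D = t i • d j - t j' • d i') ∨ (j ≤ i ∧ D = t i • d j' + t j • d i'))}

/-- The diagonal linear vector field `∑ c_i t_i d_i`. The Cartan subalgebra `𝔥_X` consists of those
diagonal vector fields that lie in `X_n`. -/
def diagonal {n : ℕ} (c : Fin n → ℂ) : Witt n := ∑ i, (c i • t i) • d i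

/-- The weight `μ_k = ε_1 + ⋯ + ε_k`, where `ε_j(t_i d_i) = δ_{ij}`, on `∑ c_i t_i d_i`. -/
def fundamentalWeight {n : ℕ} (k : ℕ) (c : Fin n → ℂ) : ℂ :=
  ∑ i : Fin n, if (i : ℕ) < k then c i else 0

/-- The `𝔏(𝔤, X_n)_0`-module `V` is (isomorphic to) `L^0_X(0, μ_k, 0)`: it is irreducible, `𝔤` and
`K_1, …, K_n` act on it by zero, and it has a highest weight vector of weight `μ_k` for
`(X_n)_0`. An irreducible highest weight module is determined up to isomorphism by its highest
weight, and it is finite-dimensional here because `μ_k` is dominant integral. -/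
def IsExceptional {n : ℕ} (g : Type*) [LieRing g] [LieAlgebra ℂ g] (X : Series n) (k : ℕ)
    (V : Type*) [AddCommGroup V] [Module ℂ V] [LieRingModule (degZero g X) V] : Prop :=
  LieModule.IsIrreducible ℂ (degZero g X) V ∧
  (∀ y : degZero g X, (y : Toroidal g X).right = 0 → ∀ v : V, ⁅y, v⁆ = 0) ∧
  ∃ v : V, v ≠ 0 ∧
    (∀ y : degZero g X, (y : Toroidal g X).left = 0 →
      ((y : Toroidal g X).right : Witt n) ∈ positiveRootVectors X → ⁅y, v⁆ = 0) ∧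
    (∀ (y : degZero g X) (c : Fin n → ℂ), (y : Toroidal g X).left = 0 →
      ((y : Toroidal g X).right : Witt n) = diagonal c → ⁅y, v⁆ = fundamentalWeight k c • v)

namespace ToroidalModule

variable {n : ℕ} {g : Type*} [LieRing g] [LieAlgebra ℂ g]
  {M : Type*} [AddCommGroup M] [Module ℂ M] [Module (Poly n) M] {X : Series n}

/-- The restriction of `σ` to `𝔏(𝔤, X_n)_0`. -/
def σ₀ (T : ToroidalModule g M X) : degZero g X →ₗ⁅ℂ⁆ Module.End ℂ M :=
  T.σ.comp (LieSubalgebra.inclusion (degZero_le_geZero g X))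

/-- A subspace is a `ρ`-submodule if it is stable under `𝔏(𝔤, X_n)` acting through `ρ`. -/
def IsRhoSubmodule (T : ToroidalModule g M X) (N : Submodule ℂ M) : Prop :=
  ∀ (y : Toroidal g X), ∀ v ∈ N, T.ρ y v ∈ N

/-- A subspace is an `(A_n, 𝔏(𝔤, X_n))`-submodule if it is stable under all three structures. -/
def IsToroidalSubmodule (T : ToroidalModule g M X) (N : Submodule ℂ M) : Prop :=
  (∀ (f : Poly n), ∀ v ∈ N, f • v ∈ N) ∧
  (∀ (y : Toroidal g X), ∀ v ∈ N, T.ρ y v ∈ N) ∧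
  (∀ (y : geZero g X), ∀ v ∈ N, T.σ y v ∈ N)

end ToroidalModule

end PolyToroidal

end

/-!
Let `N` be a subspace stable under `ρ`. Its core `{v | A_n v ⊆ N}` is the largest `A_n`-submodule
in `N`, and `A_n N` is the smallest one containing `N`. Both are stable under `ρ`; because
`σ(D) = ρ(D) - ∑ D(t_k) ρ(d_k)` for linear vector fields `D` (`ToroidalModule.ρ_linear`), both are
also stable under `σ`. It suffices to show that `N` equals its core.

The compatibility formulas say that `f ↦ ρ(D_f)` is, up to the commutator rule of the `ρ(d_k)`, a
differential operator in `f` of order one (for `D_f = f d_j`) or two (for `D_f = d_{ij}(f)` and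
`D_f = d_H(f)`). Finite differences in `r` of `ρ(D_{f t_i^r}) ρ(D_{t_i^{k-r}})` therefore leave only
the top-order part: `quadratic_difference` gives `f (E - E²)` with `E = σ(t_i d_i)` for `W_n`, and
`quartic_difference` gives `f σ(D_{t_i²})²` for `S_n` and `H_n`. As `f` is arbitrary, `E - E²`,
respectively `σ(D_{t_i²})²`, maps `N` to its core. So do `σ(x)` for `x ∈ 𝔤` and `σ(K_j)`.

If `N` is not its core, complete reducibility provides an irreducible constituent `V` of `A_n N`
that meets the core trivially (`ToroidalModule.exists_irreducible`), and all these operators vanish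
on `V`. For `W_n` the weights of `V` then consist of zeros and ones. For `S_n` and `H_n`, a
representation of `𝔰𝔩₂` with `e² = f² = 0` satisfies `h³ = h` (`sl2_cube`), so that finitely many
weights occur in `V`. In each case `V` has a highest weight vector (`exists_highest`), even though
`V` was not assumed to be finite-dimensional, and its weight is a dominant sequence of zeros and
ones, that is, some `μ_k`. Hence `V` is exceptional.
-/

noncomputable section

namespace PolyToroidal

/-! ### Finite differences of operators -/

section Difference

variable {A M : Type*} [CommRing A] [AddCommGroup M] [Module A M]

/-- The fourth finite difference of `R(f t^r) R(t^{4-r})`, for an operator `R` of order two in `f`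
whose polarized symbol in the direction `t` is `G`, where `G` in turn has the symbol `S`. The
commutator of `R f` with `t` is `c f`; in the application it is `D_f(t)` when `R f = ρ(D_f)`. -/
lemma quartic_difference {R G : A → M →+ M} {S : M →+ M} {c : A → A} {t : A}
    (hR : ∀ f v, R (f * t) v = t • R f v + f • R t v + G f v)
    (hG : ∀ f v, G (f * t) v = t • G f v + f • S v) (hG1 : G 1 = 0)
    (hRt : ∀ f v, R f (t • v) = t • R f v + c f • v)
    (hct : c t = 0)
    (hGt : ∀ f v, G f (t • v) = t • G f v) (hSt : ∀ v, S (t • v) = t • S v) (f : A) (v : M) :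
    R f (R (t * t * t * t) v) - (4 : A) • R (f * t) (R (t * t * t) v)
      + (6 : A) • R (f * t * t) (R (t * t) v) - (4 : A) • R (f * t * t * t) (R t v)
      = (6 : A) • f • S (S v) := by
  have hGt1 : ∀ v, G t v = S v := fun v => by simpa [hG1] using hG 1 v
  simp only [hR, hG, hGt1, map_add, hRt, hct, hGt, hSt, smul_add, mul_smul]
  module

/-- The second finite difference of `R(f t^r) R(t^{2-r})`, for an operator `R` of order one in `f`
with symbol `S` in the direction `t`. -/
lemma quadratic_difference {R : A → M →+ M} {S : M →+ M} {t : A}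
    (hR : ∀ f v, R (f * t) v = t • R f v + f • S v)
    (hRt : ∀ f v, R f (t • v) = t • R f v + f • v)
    (hSt : ∀ v, S (t • v) = t • S v) (f : A) (v : M) :
    R f (R (t * t) v) - (2 : A) • R (f * t) (R t v) + R (f * t * t) (R 1 v)
      = (2 : A) • f • (S v - S (S v)) := by
  have ht : ∀ v, R t v = t • R 1 v + S v := fun v => by simpa using hR 1 v
  simp only [hR, ht, map_add, hRt, hSt, smul_add, smul_sub]
  module

end Difference

/-! ### Highest weight vectors for commuting operators -/

section HighestWeight

variable {V : Type*} [AddCommGroup V] [Module ℂ V]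

/-- In a representation of `𝔰𝔩₂` with `e² = f² = 0`, the element `h` has only the eigenvalues
`-1, 0, 1`. -/
lemma sl2_cube {e f h : Module.End ℂ V} (hef : e * f - f * e = h) (hhe : h * e - e * h = 2 • e)
    (hhf : h * f - f * h = -(2 • f)) (he : e * e = 0) (hf : f * f = 0) : h * h * h = h := by
  have h1 : h * e + e * h = 0 := by
    rw [← hef, sub_mul, mul_sub, mul_assoc f e e, ← mul_assoc e e f, he]
    noncomm_ring
  have h2 : h * e = e := by
    have : 2 • (h * e) = 2 • e := by
      rw [← hhe, two_nsmul]
      rw [eq_neg_of_add_eq_zero_right h1]; abel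
    have h3 : (2:ℂ) • (h * e) = (2:ℂ) • e := by
      simpa only [← Nat.cast_smul_eq_nsmul ℂ, Nat.cast_ofNat] using this
    exact smul_right_injective _ (two_ne_zero) h3
  have h4 : h * f + f * h = 0 := by
    rw [← hef, sub_mul, mul_sub, mul_assoc e f f, ← mul_assoc f f e, hf]
    noncomm_ring
  have h5 : h * f = - f := by
    have : 2 • (h * f) = 2 • -f := by
      rw [smul_neg, ← hhf, two_nsmul]
      rw [eq_neg_of_add_eq_zero_right h4]; abel
    have h3 : (2:ℂ) • (h * f) = (2:ℂ) • -f := by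
      simpa only [← Nat.cast_smul_eq_nsmul ℂ, Nat.cast_ofNat] using this
    exact smul_right_injective _ (two_ne_zero) h3
  have h6 : h * (e * f) = e * f := by rw [← mul_assoc, h2]
  have h7 : h * (f * e) = - (f * e) := by rw [← mul_assoc, h5, neg_mul]
  calc h * h * h = h * (h * (e * f) - h * (f * e)) := by rw [← mul_sub, hef, mul_assoc]
    _ = h := by rw [h6, h7, mul_sub, mul_neg, h6, h7, neg_neg, hef]

/-- Commuting operators with `h³ = h` have a common eigenvector. -/
lemma exists_joint_eigenvector {ι : Type*} [Nontrivial V] (s : Finset ι)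
    (h : ι → Module.End ℂ V)
    (hcomm : ∀ i j, h i * h j = h j * h i) (hcube : ∀ i, h i * h i * h i = h i) :
    ∃ v : V, v ≠ 0 ∧ ∃ l : ι → ℤ, ∀ i ∈ s, h i v = (l i : ℂ) • v := by
  classical
  induction s using Finset.induction_on with
  | empty => obtain ⟨v, hv⟩ := exists_ne (0 : V); exact ⟨v, hv, 0, by simp⟩
  | insert a s ha ih =>
    obtain ⟨v, hv, l, hl⟩ := ih
    -- the projection of `v` to some eigenspace of `h a` does not vanish
    have key : ∃ (c : ℤ) (p : Module.End ℂ V), p v ≠ 0 ∧ h a * p = (c : ℂ) • p ∧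
        ∀ i, h i * p = p * h i := by
      have cc : ∀ i, h i * (h a * h a) = (h a * h a) * h i := fun i => by
        rw [← mul_assoc, hcomm i a, mul_assoc, hcomm i a, mul_assoc]
      have hc := hcube a
      rw [mul_assoc] at hc
      by_cases h0 : (1 - h a * h a) v = 0
      · by_cases h1 : (h a * h a + h a) v = 0
        · refine ⟨-1, h a * h a - h a, fun h2 => hv ?_, ?_, fun i => ?_⟩
          · simp only [LinearMap.sub_apply, LinearMap.add_apply, Module.End.one_apply] at h0 h1 h2
            have e : v = (2⁻¹ : ℂ) • (((h a * h a) v + h a v) + ((h a * h a) v - h a v))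
              + (v - (h a * h a) v) := by module
            rw [e, h0, h1, h2]; simp
          · rw [mul_sub, hc]; simp
          · rw [mul_sub, sub_mul, cc, hcomm i a]
        · exact ⟨1, _, h1, by rw [mul_add, hc]; simp [add_comm], fun i => by
            rw [mul_add, add_mul, cc, hcomm i a]⟩
      · exact ⟨0, _, h0, by rw [mul_sub, hc]; simp, fun i => by
          rw [mul_sub, sub_mul, cc, one_mul, mul_one]⟩
    obtain ⟨c, p, hp, hap, hip⟩ := key
    refine ⟨p v, hp, Function.update l a c, fun i hi => ?_⟩
    rcases Finset.mem_insert.mp hi with rfl | hi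
    · rw [Function.update_self, ← Module.End.mul_apply, hap]; rfl
    · rw [Function.update_of_ne (ne_of_mem_of_not_mem hi ha), ← Module.End.mul_apply, hip,
        Module.End.mul_apply, hl i hi, map_smul]

lemma eigenvalue_of_cube {h : Module.End ℂ V} (hcube : h * h * h = h) {v : V} (hv : v ≠ 0) {c : ℤ}
    (hc : h v = (c : ℂ) • v) : c = -1 ∨ c = 0 ∨ c = 1 := by
  have h1 : (h * h * h) v = h v := by rw [hcube]
  simp only [Module.End.mul_apply, hc, map_smul, smul_smul] at h1
  have h2 := smul_left_injective ℂ hv h1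
  have h3 : c * (c * c) = c := by exact_mod_cast h2
  have h4 : c * (c - 1) * (c + 1) = 0 := by linear_combination h3
  simp only [mul_eq_zero] at h4
  omega

/-- Commuting operators with `h³ = h` have a common eigenvector of greatest height, the height of
a weight `l` being `∑ w i * l i`. Operators that shift weights and increase the height kill it. -/
lemma exists_highest {ι : Type*} [Fintype ι] [Nontrivial V] (h : ι → Module.End ℂ V)
    (hcomm : ∀ i j, h i * h j = h j * h i) (hcube : ∀ i, h i * h i * h i = h i) (w : ι → ℤ) :
    ∃ v : V, v ≠ 0 ∧ ∃ l : ι → ℤ, (∀ i, h i v = (l i : ℂ) • v) ∧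
      ∀ (e : Module.End ℂ V) (α : ι → ℤ), (∀ i, h i * e - e * h i = (α i : ℂ) • e) →
        0 < ∑ i, w i * α i → e v = 0 := by
  classical
  let P : ℤ → Prop := fun z => ∃ v : V, v ≠ 0 ∧ ∃ l : ι → ℤ, (∀ i, h i v = (l i : ℂ) • v) ∧
    z = ∑ i, w i * l i
  have hne : ∃ z, P z := by
    obtain ⟨v, hv, l, hl⟩ := exists_joint_eigenvector Finset.univ h hcomm hcube
    exact ⟨_, v, hv, l, fun i => hl i (Finset.mem_univ i), rfl⟩
  have hbd : ∀ z, P z → z ≤ ∑ i, |w i| := by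
    rintro z ⟨v, hv, l, hl, rfl⟩
    refine Finset.sum_le_sum fun i _ => ?_
    have h1 := neg_abs_le (w i)
    have h2 := le_abs_self (w i)
    rcases eigenvalue_of_cube (hcube i) hv (hl i) with h | h | h <;> rw [h] <;> linarith
  obtain ⟨z, ⟨v, hv, l, hl, rfl⟩, hz⟩ := Int.exists_greatest_of_bdd ⟨_, hbd⟩ hne
  refine ⟨v, hv, l, hl, fun e α hα hpos => ?_⟩
  by_contra hev
  have := hz _ ⟨e v, hev, fun i => l i + α i, fun i => ?_, rfl⟩
  · simp only [mul_add, Finset.sum_add_distrib] at this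
    linarith
  · have h1 := congrArg (fun T : Module.End ℂ V => T v) (hα i)
    simp only [LinearMap.sub_apply, Module.End.mul_apply, hl, map_smul, LinearMap.smul_apply] at h1
    rw [sub_eq_iff_eq_add.mp h1]
    push_cast
    rw [add_smul, add_comm]

end HighestWeight

/-! ### Linear vector fields -/

section LinearFields

variable {n : ℕ}

lemma d_t (i j : Fin n) : d i (t j) = if i = j then 1 else 0 := by
  simp [MvPolynomial.pderiv_X, Pi.single_apply, eq_comm]

lemma d_d_quadratic (a b p q : Fin n) :
    d a (d b (t p * t q)) = (if a = p ∧ b = q then 1 else 0) + if a = q ∧ b = p then 1 else 0 := by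
  simp only [Derivation.leibniz, d_t, smul_eq_mul, map_add, mul_ite, mul_one, mul_zero]
  split_ifs <;> simp_all

lemma sum_hessian_quadratic {M : Type*} [AddCommGroup M] [Module (Poly n) M] (p q : Fin n)
    (F : Fin n → Fin n → M) :
    ∑ a, ∑ b, d a (d b (t p * t q)) • F a b = F p q + F q p := by
  simp only [d_d_quadratic, add_smul, Finset.sum_add_distrib, ite_smul, one_smul, zero_smul,
    ite_and]
  simp

/-- The space `(X_n)_0` of linear vector fields in `X_n`. -/
def linearFields (X : Series n) : Submodule ℂ (Witt n) where
  carrier := {D | D ∈ vectorFields X ∧ ∀ j, (D (t j)).IsHomogeneous 1}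
  add_mem' h k := ⟨add_mem h.1 k.1, fun j => (h.2 j).add (k.2 j)⟩
  zero_mem' := ⟨zero_mem _, fun _ => MvPolynomial.isHomogeneous_zero _ _ _⟩
  smul_mem' c _ h := ⟨(vectorFields X).smul_mem c h.1,
    fun j => (MvPolynomial.homogeneousSubmodule (Fin n) ℂ 1).smul_mem c (h.2 j)⟩

/-- The generators of `(X_n)_0` on which the compatibility of `ρ` and `σ` determines `σ`. -/
def linearGenerators : Series n → Set (Witt n)
  | .W => {D | ∃ i j : Fin n, D = t i • d j}
  | .S => {D | ∃ i j a b : Fin n, i < j ∧ D = dS i j (t a * t b)}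
  | .H m _ => {D | ∃ a b : Fin n, D = dH m (t a * t b)}

lemma exists_coeff_of_homogeneous_zero {p : Poly n} (hp : p.IsHomogeneous 0) :
    ∃ c : ℂ, p = MvPolynomial.C c :=
  ⟨_, MvPolynomial.totalDegree_eq_zero_iff_eq_C.mp
    ((MvPolynomial.totalDegree_zero_iff_isHomogeneous _).mpr hp)⟩

lemma sum_t_mul_d {p : Poly n} (hp : p.IsHomogeneous 1) : ∑ a, t a * d a p = p := by
  simpa using hp.sum_X_mul_pderiv

lemma exists_coeff_of_homogeneous_one {p : Poly n} (hp : p.IsHomogeneous 1) :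
    ∃ c : Fin n → ℂ, p = ∑ a, c a • t a := by
  choose c hc using fun a => exists_coeff_of_homogeneous_zero (hp.pderiv (i := a))
  refine ⟨c, ?_⟩
  conv_lhs => rw [← sum_t_mul_d hp]
  exact Finset.sum_congr rfl fun a _ => by
    rw [show d a p = _ from hc a, MvPolynomial.smul_eq_C_mul, mul_comm]

/-- A linear vector field is `∑ c a j t_a d_j` for a matrix `c`. -/
lemma exists_matrix_of_linear {D : Witt n} (hD : ∀ j, (D (t j)).IsHomogeneous 1) :
    ∃ c : Fin n → Fin n → ℂ, (∀ j, D (t j) = ∑ a, c a j • t a) ∧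
      D = ∑ j, ∑ a, c a j • (t a • d j : Witt n) := by
  choose c hc using fun j => exists_coeff_of_homogeneous_one (hD j)
  refine ⟨fun a j => c j a, hc, ?_⟩
  apply MvPolynomial.derivation_ext
  intro k
  simp only [witt_sum_apply, Derivation.smul_apply, d_t]
  rw [hc]
  simp

lemma t_smul_d_eq_dS {i j : Fin n} (h : i ≠ j) :
    (t i • d j : Witt n) = (-1 / 2 : ℂ) • dS i j (t i * t i) := by
  apply MvPolynomial.derivation_ext
  intro k
  change t i * d j (t k) = (-1 / 2 : ℂ) • dS i j (t i * t i) (t k)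
  simp only [dS_apply_t, Derivation.leibniz, d_t, smul_eq_mul, if_neg h.symm, if_true,
    @eq_comm _ j k, mul_ite, mul_one, mul_zero, add_zero, ite_self]
  split_ifs <;> module

lemma dS_swap (i j : Fin n) (f : Poly n) : dS j i f = -dS i j f := by simp [dS]

lemma dS_t_mul_t {i j : Fin n} (h : i ≠ j) :
    dS i j (t i * t j) = (t i • d i - t j • d j : Witt n) := by
  simp [dS, Derivation.leibniz, h, h.symm]

lemma dS_mem_span {i j : Fin n} (h : i ≠ j) (a b : Fin n) :
    dS i j (t a * t b) ∈ Submodule.span ℂ (linearGenerators (.S : Series n)) := by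
  rcases lt_or_gt_of_ne h with h | h
  · exact Submodule.subset_span ⟨i, j, a, b, h, rfl⟩
  · rw [dS_swap]
    exact Submodule.neg_mem _ (Submodule.subset_span ⟨j, i, a, b, h, rfl⟩)

lemma dH_add (m : ℕ) (f h : Poly n) : dH m (f + h) = dH m f + dH m h := by
  simp only [dH, map_add, smul_add, add_smul, Finset.sum_add_distrib]

lemma dH_smul (m : ℕ) (c : ℂ) (f : Poly n) : dH m (c • f) = c • dH m f := by
  simp only [dH, Derivation.map_smul, Finset.smul_sum]
  exact Finset.sum_congr rfl fun a _ => Finset.sum_congr rfl fun b _ => by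
    rw [smul_comm, smul_assoc]

/-- A Hamiltonian vector field with linear coefficients is `d_H` of a quadratic form. -/
lemma exists_dH_eq {m : ℕ} (hm : n = 2 * m) {D : Witt n} (hD : D ∈ hamiltonianAlgebra n m)
    (hlin : ∀ j, (D (t j)).IsHomogeneous 1) :
    ∃ p : Fin n → Fin n → ℂ, D = dH m (∑ k, ∑ a, p k a • (t a * t k)) := by
  set g' : Fin n → Poly n := fun a => -∑ c, sympl m c a • D (t c) with hg
  have hg1 : ∀ a, (g' a).IsHomogeneous 1 := fun a =>
    Submodule.neg_mem (MvPolynomial.homogeneousSubmodule (Fin n) ℂ 1) <|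
      Submodule.sum_mem _ fun c _ => Submodule.smul_mem _ _ (hlin c)
  -- the 1-form `∑ g' a dt_a` is closed
  have closed : ∀ a b, d a (g' b) = d b (g' a) := by
    intro a b
    have h := hD a b
    simp only [lieDerivSympl, Finset.sum_add_distrib, sympl_swap hm _ a, neg_smul,
      Finset.sum_neg_distrib] at h
    simp only [hg, map_neg, map_sum, Derivation.map_smul]
    rw [← sub_eq_zero, ← neg_eq_zero, ← h]
    ring
  choose e he using fun a => exists_coeff_of_homogeneous_one (hg1 a)
  have hf : ∑ k, ∑ a, (1 / 2 * e k a : ℂ) • (t a * t k) = (1 / 2 : ℂ) • ∑ k, g' k * t k := by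
    rw [Finset.smul_sum]
    refine Finset.sum_congr rfl fun k _ => ?_
    rw [he, Finset.sum_mul, Finset.smul_sum]
    exact Finset.sum_congr rfl fun a _ => by rw [mul_smul, smul_mul_assoc]
  refine ⟨fun k a => 1 / 2 * e k a, ?_⟩
  have hd : ∀ a, d a ((1 / 2 : ℂ) • ∑ k, g' k * t k) = g' a := by
    intro a
    have h1 : ∑ k, t k * d a (g' k) = g' a := by
      simp only [closed a]; exact sum_t_mul_d (hg1 a)
    rw [Derivation.map_smul, map_sum]
    simp only [Derivation.leibniz, d_t, smul_eq_mul, Finset.sum_add_distrib, h1]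
    simp only [mul_ite, mul_one, mul_zero, Finset.sum_ite_eq, Finset.mem_univ, if_true]
    rw [← two_smul ℂ, smul_smul]; norm_num
  apply MvPolynomial.derivation_ext
  intro k
  change D (t k) = dH m _ (t k)
  rw [dH_apply_t, hf]
  simp only [hd]
  simp only [hg, smul_neg, Finset.smul_sum, smul_smul, Finset.sum_neg_distrib]
  rw [Finset.sum_comm]
  have : ∀ c, ∑ a, (sympl m a k * sympl m c a) • D (t c)
      = (if c = k then -1 else 0 : ℂ) • D (t c) := by
    intro c
    rw [← sympl_sq hm c k, Finset.sum_smul]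
    exact Finset.sum_congr rfl fun a _ => by rw [mul_comm]
  simp [this]

lemma linearFields_le_span (X : Series n) :
    linearFields X ≤ Submodule.span ℂ (linearGenerators X) := by
  rintro D ⟨hD, hlin⟩
  cases X with
  | W =>
    obtain ⟨c, -, rfl⟩ := exists_matrix_of_linear hlin
    exact Submodule.sum_mem _ fun j _ => Submodule.sum_mem _ fun a _ =>
      Submodule.smul_mem _ _ (Submodule.subset_span ⟨a, j, rfl⟩)
  | S =>
    obtain ⟨c, hc, hDc⟩ := exists_matrix_of_linear hlin
    have htr : ∑ j, c j j = 0 := by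
      have h : divergence D = 0 := hD
      simp only [divergence, hc, map_sum, Derivation.map_smul, d_t] at h
      simp only [smul_ite, smul_zero, Finset.sum_ite_eq, Finset.mem_univ, if_true,
        MvPolynomial.smul_eq_C_mul, mul_one, ← map_sum] at h
      exact (MvPolynomial.C_eq_zero).mp h
    rcases n with _ | n
    · rw [hDc]; simp
    -- the trace vanishes, so a fixed diagonal entry may be subtracted from all of them
    have hD2 : D = ∑ j, ∑ a, c a j • (t a • d j -
        if a = j then (t (0 : Fin (n + 1)) • d 0 : Witt (n + 1)) else 0) := by
      rw [hDc]
      simp only [smul_sub, Finset.sum_sub_distrib, smul_ite, smul_zero, Finset.sum_ite_eq',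
        Finset.mem_univ, if_true]
      rw [← Finset.sum_smul, htr, zero_smul, sub_zero]
    rw [hD2]
    refine Submodule.sum_mem _ fun j _ => Submodule.sum_mem _ fun a _ =>
      Submodule.smul_mem _ _ ?_
    split_ifs with h
    · subst h
      by_cases h0 : a = 0
      · rw [h0, sub_self]; exact Submodule.zero_mem _
      · rw [← dS_t_mul_t h0]; exact dS_mem_span h0 _ _
    · rw [sub_zero, t_smul_d_eq_dS h]
      exact Submodule.smul_mem _ _ (dS_mem_span h _ _)
  | H m hm =>
    obtain ⟨p, rfl⟩ := exists_dH_eq hm hD hlin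
    let L : Poly n →ₗ[ℂ] Witt n :=
      { toFun := dH m, map_add' := dH_add m, map_smul' := dH_smul m }
    change L _ ∈ _
    simp only [map_sum, map_smul]
    exact Submodule.sum_mem _ fun j _ => Submodule.sum_mem _ fun a _ =>
      Submodule.smul_mem _ _ (Submodule.subset_span ⟨a, j, rfl⟩)

end LinearFields

/-! ### The degree zero part of the toroidal algebra -/

section DegZero

variable {n : ℕ} (g : Type*) [LieRing g] [LieAlgebra ℂ g] (X : Series n)

/-- The inclusion of the linear vector fields of `X_n` into `𝔏(𝔤, X_n)_0`. -/
def degZeroField : linearFields X →ₗ[ℂ] degZero g X where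
  toFun D := ⟨ofField g D D.2.1, Submodule.zero_mem _,
    fun _ => MvPolynomial.isHomogeneous_zero _ _ _, D.2.2⟩
  map_add' D E := Subtype.ext (by
    ext1
    · exact (add_zero (0 : Current n g)).symm
    · rfl)
  map_smul' c D := Subtype.ext (by
    ext1
    · exact (smul_zero c : c • (0 : Current n g) = 0).symm
    · rfl)

variable {g X}

lemma lie_degZeroField {D E F : linearFields X} (h : ⁅(D : Witt n), (E : Witt n)⁆ = F) :
    ⁅degZeroField g X D, degZeroField g X E⁆ = degZeroField g X F := by
  refine Subtype.ext ?_
  ext1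
  · change ⁅(0 : Current n g), (0 : Current n g)⁆ + wittAction n g D 0 - wittAction n g E 0 = 0
    simp
  · exact Subtype.ext h

lemma eq_degZeroField {y : degZero g X} (hy : (y : Toroidal g X).left = 0) :
    y = degZeroField g X ⟨(y : Toroidal g X).right, (y : Toroidal g X).right.2, y.2.2.2⟩ := by
  refine Subtype.ext ?_
  ext1
  · exact hy
  · rfl

/-- `x ∈ 𝔤` as an element of `𝔏(𝔤, X_n)_0`. -/
def degZeroLie (X : Series n) (x : g) : degZero g X :=
  ⟨ofCurrent X 1 x, Submodule.subset_span ⟨1, x, MvPolynomial.isHomogeneous_one _ _, rfl⟩,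
    fun _ => MvPolynomial.isHomogeneous_zero _ _ _, fun _ => MvPolynomial.isHomogeneous_zero _ _ _⟩

/-- `K_j` as an element of `𝔏(𝔤, X_n)_0`. -/
def degZeroK (g : Type*) [LieRing g] [LieAlgebra ℂ g] (X : Series n) (j : Fin n) : degZero g X :=
  ⟨ofCentral g X 1 j, Submodule.zero_mem _, fun i => by
      by_cases h : i = j
      · subst h; simp [ofCentral, Central.mk, MvPolynomial.isHomogeneous_one]
      · simp [ofCentral, Central.mk, h, MvPolynomial.isHomogeneous_zero],
    fun _ => MvPolynomial.isHomogeneous_zero _ _ _⟩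

lemma exists_of_mem_currentGrade_zero {u : CurrentAlgebra (Poly n) g}
    (hu : u ∈ currentGrade n g 0) : ∃ x : g, u = CurrentAlgebra.mk 1 x := by
  induction hu using Submodule.span_induction with
  | zero => exact ⟨0, (TensorProduct.tmul_zero _ _).symm⟩
  | add u v _ _ hu hv =>
    obtain ⟨x, rfl⟩ := hu
    obtain ⟨y, rfl⟩ := hv
    exact ⟨x + y, (TensorProduct.tmul_add _ _ _).symm⟩
  | smul c u _ hu =>
    obtain ⟨x, rfl⟩ := hu
    exact ⟨c • x, (TensorProduct.tmul_smul _ _ _).symm⟩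
  | mem u hu =>
    obtain ⟨f, x, hf, rfl⟩ := hu
    obtain ⟨c, rfl⟩ := exists_coeff_of_homogeneous_zero hf
    refine ⟨c • x, ?_⟩
    have h : (MvPolynomial.C c : Poly n) = c • 1 := by
      rw [MvPolynomial.smul_eq_C_mul, mul_one]
    rw [h]
    exact (TensorProduct.smul_tmul c 1 x)

/-- `𝔏(𝔤, X_n)_0 = 𝔤 ⊕ span {K_1, …, K_n} ⊕ (X_n)_0`. -/
lemma exists_degZero_decomposition (y : degZero g X) : ∃ (x : g) (c : Fin n → ℂ),
    y = degZeroLie X x + ∑ j, c j • degZeroK g X j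
      + degZeroField g X ⟨(y : Toroidal g X).right, (y : Toroidal g X).right.2, y.2.2.2⟩ := by
  obtain ⟨x, hx⟩ := exists_of_mem_currentGrade_zero y.2.1
  choose c hc using fun j => exists_coeff_of_homogeneous_zero (y.2.2.1 j)
  refine ⟨x, c, Subtype.ext ?_⟩
  have hK : ((∑ j, c j • degZeroK g X j : degZero g X) : Toroidal g X)
      = LieAlgebra.SemiDirectSum.inl _ (∑ j, c j • ((0, Central.mk 1 j) : Current n g)) := by
    rw [map_sum]
    change (degZero g X).toSubmodule.subtype (∑ j, c j • degZeroK g X j) = _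
    rw [map_sum]
    exact Finset.sum_congr rfl fun j _ => by rw [map_smul, map_smul]; rfl
  have hz : (∑ j, c j • ((0, Central.mk 1 j) : Current n g)) = (0, (y : Toroidal g X).left.2) := by
    refine Prod.ext ?_ ?_
    · simp [Prod.fst_sum]
    · rw [Prod.snd_sum]
      funext i
      change (∑ j, c j • (Pi.single j 1 : Fin n → Poly n)) i = _
      rw [hc i]
      simp [Finset.sum_apply, Pi.single_apply, MvPolynomial.smul_eq_C_mul]
  change _ = ofCurrent X 1 x + ((∑ j, c j • degZeroK g X j : degZero g X) : Toroidal g X)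
    + ofField g (y : Toroidal g X).right (y : Toroidal g X).right.2
  rw [hK, hz]
  ext1
  · refine Prod.ext ?_ ?_
    · change _ = CurrentAlgebra.mk 1 x + 0 + 0
      rw [add_zero, add_zero]; exact hx
    · change _ = 0 + (y : Toroidal g X).left.2 + 0
      rw [add_zero, zero_add]
  · change _ = 0 + 0 + (y : Toroidal g X).right
    rw [add_zero, zero_add]

end DegZero

attribute [local instance] LieRing.ofAssociativeRing

/-! ### Operators mapping a subspace to its core -/

section SecondOrder

variable {n : ℕ} {M : Type*} [AddCommGroup M] [Module ℂ M] [Module (Poly n) M]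

/-- The largest `A_n`-submodule contained in a subspace. -/
def core (N : Submodule ℂ M) : Submodule (Poly n) M where
  carrier := {v | ∀ f : Poly n, f • v ∈ N}
  add_mem' hv hw f := by rw [smul_add]; exact N.add_mem (hv f) (hw f)
  zero_mem' f := by rw [smul_zero]; exact N.zero_mem
  smul_mem' h v hv f := by rw [smul_smul]; exact hv _

lemma core_le {N : Submodule ℂ M} {v : M} (hv : v ∈ core (n := n) N) : v ∈ N := by
  simpa using hv 1

variable [IsScalarTower ℂ (Poly n) M]

/-- Operators `R f = ρ(D_f)` of order two in `f`, with `D_f = ∑ J a b d_a(f) d_b`: the square of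
`S i i = σ(D_{t_i²})` maps `N` to its core. The hypothesis `hJ` says that `D_{t_i}(t_i) = 0`. -/
lemma sq_mem_core_of_second_order {R : Poly n → Module.End ℂ M} {J : Fin n → Fin n → ℂ}
    {P : Fin n → Module.End ℂ M} {S : Fin n → Fin n → Module.End ℂ M} {N : Submodule ℂ M}
    (hR : ∀ f v, R f v = ∑ a, ∑ b, (J a b • d a f) • P b v
      + (1 / 2 : ℂ) • ∑ a, ∑ b, d a (d b f) • S a b v)
    (hP : ∀ b (f : Poly n) v, P b (f • v) = f • P b v + d b f • v)
    (hS : ∀ a b (f : Poly n) v, S a b (f • v) = f • S a b v) (hsymm : ∀ a b, S a b = S b a)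
    (hN : ∀ f, ∀ v ∈ N, R f v ∈ N) {i : Fin n} (hJ : J i i = 0) {v : M} (hv : v ∈ N) :
    S i i (S i i v) ∈ core (n := n) N := by
  let G : Poly n → M →+ M := fun f => ∑ a, d a f • (S a i).toAddMonoidHom
  have hG : ∀ f v, G f v = ∑ a, d a f • S a i v := fun f v => by
    simp [G]
  intro f
  have key := quartic_difference (R := fun f => (R f).toAddMonoidHom) (G := G)
    (S := (S i i).toAddMonoidHom) (c := fun f => ∑ a, J a i • d a f) (t := t i)
    ?_ ?_ ?_ ?_ ?_ ?_ ?_ f v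
  · simp only [LinearMap.toAddMonoidHom_coe] at key
    have e4 : ∀ w : M, (4 : Poly n) • w = (4 : ℂ) • w := fun w => by
      rw [← algebraMap_smul (Poly n) (4 : ℂ) w, map_ofNat]
    have e6 : ∀ w : M, (6 : Poly n) • w = (6 : ℂ) • w := fun w => by
      rw [← algebraMap_smul (Poly n) (6 : ℂ) w, map_ofNat]
    simp only [e4, e6] at key
    have h6 : (6 : ℂ) • f • S i i (S i i v) ∈ N := by
      rw [← key]
      exact N.sub_mem (N.add_mem (N.sub_mem (hN _ _ (hN _ _ hv))
        (N.smul_mem _ (hN _ _ (hN _ _ hv)))) (N.smul_mem _ (hN _ _ (hN _ _ hv))))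
        (N.smul_mem _ (hN _ _ (hN _ _ hv)))
    have := N.smul_mem (6⁻¹ : ℂ) h6
    rwa [smul_smul, inv_mul_cancel₀ (by norm_num), one_smul] at this
  · intro f v
    simp only [LinearMap.toAddMonoidHom_coe, hR, hG]
    have e1 : ∑ a, ∑ b, (J a b • d a (f * t i)) • P b v
        = t i • (∑ a, ∑ b, (J a b • d a f) • P b v)
          + f • ∑ a, ∑ b, (J a b • d a (t i)) • P b v := by
      simp only [Finset.smul_sum, ← Finset.sum_add_distrib]
      refine Finset.sum_congr rfl fun a _ => Finset.sum_congr rfl fun b _ => ?_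
      simp only [Derivation.leibniz, MvPolynomial.smul_eq_C_mul, smul_eq_mul]
      module
    have e2 : ∑ a, ∑ b, d a (d b (f * t i)) • S a b v
        = t i • (∑ a, ∑ b, d a (d b f) • S a b v) + (2 : ℂ) • ∑ a, d a f • S a i v := by
      have : ∀ a b, d a (d b (f * t i)) • S a b v = t i • d a (d b f) • S a b v
          + ((if b = i then d a f • S a i v else 0) + if a = i then d b f • S b i v else 0) := by
        intro a b
        simp only [Derivation.leibniz, d_t, smul_eq_mul, map_add]
        split_ifs with h1 h2 h2
        all_goals simp only [map_zero, Derivation.map_one_eq_zero]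
        · subst h1; subst h2; module
        · subst h1; module
        · subst h2; rw [hsymm a b]; module
        · module
      simp only [this, Finset.sum_add_distrib, Finset.sum_ite_eq', Finset.mem_univ, if_true,
        Finset.smul_sum]
      rw [Finset.sum_comm (f := fun a b => if a = i then d b f • S b i v else 0)]
      simp [two_smul, ← Finset.smul_sum, Finset.sum_add_distrib]
    have e3 : ∑ a, ∑ b, d a (d b (t i)) • S a b v = 0 := by
      refine Finset.sum_eq_zero fun a _ => Finset.sum_eq_zero fun b _ => ?_
      rw [d_t]; split_ifs <;> simp
    rw [e1, e2, e3, smul_zero, add_zero, smul_add, smul_add, smul_smul,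
      smul_comm (1 / 2 : ℂ) (t i)]
    norm_num
    abel
  · intro f v
    simp only [LinearMap.toAddMonoidHom_coe, hG, Finset.smul_sum]
    have : ∀ a, d a (f * t i) • S a i v = t i • d a f • S a i v
        + if a = i then f • S i i v else 0 := by
      intro a
      simp only [Derivation.leibniz, d_t, smul_eq_mul]
      split_ifs with h
      · subst h; module
      · module
    simp only [this, Finset.sum_add_distrib, Finset.sum_ite_eq', Finset.mem_univ, if_true]
  · simp [G]
  · intro f v
    simp only [LinearMap.toAddMonoidHom_coe, hR, hP, hS]
    have e : ∀ a b, (J a b • d a f) • (t i • P b v + d b (t i) • v)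
        = t i • (J a b • d a f) • P b v + if b = i then (J a i • d a f) • v else 0 := by
      intro a b
      rw [d_t]
      split_ifs with h
      · subst h; module
      · module
    simp only [e, Finset.sum_add_distrib, Finset.sum_ite_eq', Finset.mem_univ, if_true,
      ← Finset.sum_smul, smul_comm _ (t i) (S _ _ _), ← Finset.smul_sum]
    rw [smul_add, smul_comm (1 / 2 : ℂ) (t i)]
    abel
  · simp only [d_t, smul_ite, smul_zero, Finset.sum_ite_eq', Finset.mem_univ, if_true, hJ,
      zero_smul]
  · intro f v
    simp only [hG, hS, Finset.smul_sum]
    exact Finset.sum_congr rfl fun a _ => smul_comm _ _ _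
  · intro v; exact hS _ _ _ _

/-- Operators `R f = ρ(f d_i)` of order one in `f`: with `S i = σ(t_i d_i)`, the operator
`S i - S i ^ 2` maps `N` to its core. -/
lemma sub_sq_mem_core_of_first_order {R : Poly n → Module.End ℂ M} {p : Module.End ℂ M}
    {S : Fin n → Module.End ℂ M} {N : Submodule ℂ M} {i : Fin n}
    (hR : ∀ f v, R f v = f • p v + ∑ a, d a f • S a v)
    (hP : ∀ (f : Poly n) v, p (f • v) = f • p v + d i f • v)
    (hS : ∀ a (f : Poly n) v, S a (f • v) = f • S a v)
    (hN : ∀ f, ∀ v ∈ N, R f v ∈ N) {v : M} (hv : v ∈ N) :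
    S i v - S i (S i v) ∈ core (n := n) N := by
  intro f
  have key := quadratic_difference (R := fun f => (R f).toAddMonoidHom)
    (S := (S i).toAddMonoidHom) (t := t i) ?_ ?_ ?_ f v
  · simp only [LinearMap.toAddMonoidHom_coe] at key
    have e2 : ∀ w : M, (2 : Poly n) • w = (2 : ℂ) • w := fun w => by
      rw [← algebraMap_smul (Poly n) (2 : ℂ) w, map_ofNat]
    simp only [e2] at key
    have h2 : (2 : ℂ) • f • (S i v - S i (S i v)) ∈ N := by
      rw [← key]
      exact N.add_mem (N.sub_mem (hN _ _ (hN _ _ hv))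
        (N.smul_mem _ (hN _ _ (hN _ _ hv)))) (hN _ _ (hN _ _ hv))
    have := N.smul_mem (2⁻¹ : ℂ) h2
    rwa [smul_smul, inv_mul_cancel₀ (by norm_num), one_smul] at this
  · intro f v
    simp only [LinearMap.toAddMonoidHom_coe, hR, smul_add, Finset.smul_sum]
    have : ∀ a, d a (f * t i) • S a v = t i • d a f • S a v + if a = i then f • S i v else 0 := by
      intro a
      simp only [Derivation.leibniz, d_t, smul_eq_mul]
      split_ifs with h
      · subst h; module
      · module
    simp only [this, Finset.sum_add_distrib, Finset.sum_ite_eq', Finset.mem_univ, if_true]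
    module
  · intro f v
    simp only [LinearMap.toAddMonoidHom_coe, hR, hP, hS, smul_add, Finset.smul_sum,
      smul_comm _ (t i) (S _ _), d_t, if_true]
    module
  · intro v; exact hS _ _ _

end SecondOrder

/-! ### Submodules of toroidal modules -/

namespace ToroidalModule

variable {n : ℕ} {g : Type*} [LieRing g] [LieAlgebra ℂ g]
  {M : Type*} [AddCommGroup M] [Module ℂ M] [Module (Poly n) M] {X : Series n}
  (T : ToroidalModule g M X)

/-- The operator `ρ(d_i)`. -/
def partialOp (i : Fin n) : Module.End ℂ M := T.ρ (ofField g (d i) (d_mem X i))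

/-- Leibniz rule for `ρ`. -/
lemma ρ_smul (y : Toroidal g X) (f : Poly n) (v : M) :
    T.ρ y (f • v) = f • T.ρ y v + (y.right : Witt n) f • v := by
  have hy : y = ⟨y.left, 0⟩ + ofField g y.right y.right.2 := by
    ext1
    · exact (add_zero y.left).symm
    · exact (zero_add y.right).symm
  have hr (w : M) : T.ρ y w = T.ρ ⟨y.left, 0⟩ w + T.ρ (ofField g y.right y.right.2) w := by
    conv_lhs => rw [hy, map_add, LinearMap.add_apply]
  rw [hr, hr, T.ρ_current, T.ρ_field, smul_add, add_assoc]

lemma partialOp_smul (i : Fin n) (f : Poly n) (v : M) :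
    T.partialOp i (f • v) = f • T.partialOp i v + d i f • v :=
  T.ρ_field _ _ _ _

lemma σ₀_smul (y : degZero g X) (f : Poly n) (v : M) : T.σ₀ y (f • v) = f • T.σ₀ y v :=
  T.σ_smul _ _ _

lemma sum_smul_partialOp_dS (i j : Fin n) (f : Poly n) (v : M) :
    ∑ k, dS i j f (t k) • T.partialOp k v
      = d j f • T.partialOp i v - d i f • T.partialOp j v := by
  simp [dS_apply_t, sub_smul, Finset.sum_sub_distrib, ite_smul]

lemma sum_smul_partialOp_dH (m : ℕ) (f : Poly n) (v : M) :
    ∑ k, dH m f (t k) • T.partialOp k v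
      = ∑ a, ∑ b, (sympl m a b • d a f) • T.partialOp b v := by
  simp only [dH_apply_t, Finset.sum_smul]
  exact Finset.sum_comm

lemma σ₀_degZeroLie (x : g) (v : M) : T.σ₀ (degZeroLie X x) v = T.ρ (ofCurrent X 1 x) v := by
  rw [T.ρ_lie, one_smul]; rfl

lemma σ₀_degZeroK (j : Fin n) (v : M) : T.σ₀ (degZeroK g X j) v = T.ρ (ofCentral g X 1 j) v := by
  rw [T.ρ_K, one_smul]; rfl

lemma ρ_mem_core {N : Submodule ℂ M} (hN : T.IsRhoSubmodule N) (y : Toroidal g X) :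
    ∀ v ∈ core (n := n) N, T.ρ y v ∈ core (n := n) N := by
  intro v hv f
  rw [← sub_eq_of_eq_add (T.ρ_smul y f v)]
  exact N.sub_mem (hN _ _ (hv f)) (hv _)

lemma ρ_mem_span {N : Submodule ℂ M} (hN : T.IsRhoSubmodule N) (y : Toroidal g X) :
    ∀ v ∈ Submodule.span (Poly n) (N : Set M), T.ρ y v ∈ Submodule.span (Poly n) (N : Set M) := by
  intro v hv
  induction hv using Submodule.span_induction with
  | mem v hv => exact Submodule.subset_span (hN _ _ hv)
  | zero => rw [map_zero]; exact Submodule.zero_mem _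
  | add v w _ _ hv hw => rw [map_add]; exact Submodule.add_mem _ hv hw
  | smul f v h hv =>
    rw [T.ρ_smul]
    exact Submodule.add_mem _ (Submodule.smul_mem _ _ hv) (Submodule.smul_mem _ _ h)

/-- An `A_n`-linear operator that maps `N` to its core also maps `A_n N` there. -/
lemma mem_core_of_span {N : Submodule ℂ M} {q : Module.End ℂ M}
    (hq : ∀ (f : Poly n) v, q (f • v) = f • q v) (hqN : ∀ v ∈ N, q v ∈ core (n := n) N) {v : M}
    (hv : v ∈ Submodule.span (Poly n) (N : Set M)) : q v ∈ core (n := n) N := by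
  induction hv using Submodule.span_induction with
  | mem v hv => exact hqN v hv
  | zero => rw [map_zero]; exact Submodule.zero_mem _
  | add v w _ _ hv hw => rw [map_add]; exact Submodule.add_mem _ hv hw
  | smul f v _ hv => rw [hq]; exact Submodule.smul_mem _ _ hv

/-- The relation between `ρ(D)` and `σ(D)` for the generators `D`, read off from `compat`. -/
lemma ρ_generator {D : Witt n} (hD : D ∈ linearGenerators X) :
    ∃ h : D ∈ linearFields X, ∀ v, T.ρ (ofField g D h.1) v
      = ∑ k, D (t k) • T.partialOp k v + T.σ₀ (degZeroField g X ⟨D, h⟩) v := by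
  cases X with
  | W =>
    obtain ⟨i, j, rfl⟩ := hD
    refine ⟨⟨LieSubalgebra.mem_top _, linear_W i j⟩, fun v => ?_⟩
    rw [T.compat (t i) j v]
    congr 1
    · simp only [Derivation.smul_apply, d_t, smul_eq_mul, mul_ite, mul_one, mul_zero, ite_smul,
        zero_smul, Finset.sum_ite_eq, Finset.mem_univ, if_true]
      rfl
    · simp only [d_t, ite_smul, one_smul, zero_smul, Finset.sum_ite_eq', Finset.mem_univ, if_true]
      rfl
  | S =>
    obtain ⟨i, j, a, b, hij, rfl⟩ := hD
    refine ⟨⟨dS_mem i j _, linear_S i j a b⟩, fun v => ?_⟩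
    rw [T.compat (t a * t b) i j v hij, sum_smul_partialOp_dS]
    congr 1
    have hs : linS g i j b a = linS g i j a b := by simp only [linS, mul_comm]
    rw [sum_hessian_quadratic a b (fun a b => T.σ (linS g i j a b) v), hs, ← two_smul ℂ, smul_smul]
    norm_num
    rfl
  | H m hm =>
    obtain ⟨a, b, rfl⟩ := hD
    refine ⟨⟨dH_mem hm _, linear_H m a b⟩, fun v => ?_⟩
    rw [T.compat (t a * t b) v, sum_smul_partialOp_dH]
    congr 1
    have hs : linH g m hm b a = linH g m hm a b := by simp only [linH, mul_comm]
    rw [sum_hessian_quadratic a b (fun a b => T.σ (linH g m hm a b) v), hs, ← two_smul ℂ,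
      smul_smul]
    norm_num
    rfl

variable [IsScalarTower ℂ (Poly n) M]

/-- `ρ(D) = ∑ D(t_k) ρ(d_k) + σ(D)` for the linear vector fields `D` in `X_n`. -/
lemma ρ_linear (D : linearFields X) (v : M) :
    T.ρ (ofField g D D.2.1) v
      = ∑ k, (D : Witt n) (t k) • T.partialOp k v + T.σ₀ (degZeroField g X D) v := by
  suffices H : ∀ D ∈ Submodule.span ℂ (linearGenerators X), ∃ h : D ∈ linearFields X,
      ∀ v, T.ρ (ofField g D h.1) v
        = ∑ k, D (t k) • T.partialOp k v + T.σ₀ (degZeroField g X ⟨D, h⟩) v by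
    exact (H D (linearFields_le_span X D.2)).2 v
  intro D hD
  induction hD using Submodule.span_induction with
  | mem D hD => exact T.ρ_generator hD
  | zero =>
    refine ⟨Submodule.zero_mem _, fun v => ?_⟩
    have h1 : ofField g (0 : Witt n) (zero_mem (vectorFields X)) = 0 := rfl
    have h2 : (⟨0, Submodule.zero_mem _⟩ : linearFields X) = 0 := rfl
    rw [h1, h2, map_zero, map_zero, map_zero]
    simp
  | add D E _ _ hD hE =>
    obtain ⟨hD, eD⟩ := hD
    obtain ⟨hE, eE⟩ := hE
    refine ⟨Submodule.add_mem _ hD hE, fun v => ?_⟩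
    have h1 : ofField g (D + E) (add_mem hD.1 hE.1) = ofField g D hD.1 + ofField g E hE.1 := by
      ext1
      · exact (add_zero (0 : Current n g)).symm
      · rfl
    have h2 : (⟨D + E, Submodule.add_mem _ hD hE⟩ : linearFields X) = ⟨D, hD⟩ + ⟨E, hE⟩ := rfl
    rw [h1, h2, map_add, map_add, map_add, LinearMap.add_apply, LinearMap.add_apply, eD, eE]
    simp only [Derivation.add_apply, add_smul, Finset.sum_add_distrib]
    abel
  | smul c D _ hD =>
    obtain ⟨hD, eD⟩ := hD
    refine ⟨Submodule.smul_mem _ c hD, fun v => ?_⟩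
    have h1 : ofField g (c • D) ((vectorFields X).smul_mem c hD.1) = c • ofField g D hD.1 := by
      ext1
      · exact (smul_zero c : c • (0 : Current n g) = 0).symm
      · rfl
    have h2 : (⟨c • D, Submodule.smul_mem _ c hD⟩ : linearFields X) = c • ⟨D, hD⟩ := rfl
    rw [h1, h2, map_smul, map_smul, map_smul, LinearMap.smul_apply, LinearMap.smul_apply, eD]
    simp only [Derivation.smul_apply, smul_add, Finset.smul_sum, smul_assoc]

/-- An `A_n`-submodule that is stable under `ρ` is stable under `σ` in degree zero. -/
lemma σ₀_mem {N : Submodule (Poly n) M} (hN : ∀ y, ∀ v ∈ N, T.ρ y v ∈ N) (y : degZero g X)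
    {v : M} (hv : v ∈ N) : T.σ₀ y v ∈ N := by
  obtain ⟨x, c, hy⟩ := exists_degZero_decomposition y
  rw [hy, map_add, map_add, map_sum, LinearMap.add_apply, LinearMap.add_apply,
    LinearMap.sum_apply]
  refine N.add_mem (N.add_mem ?_ (N.sum_mem fun j _ => ?_)) ?_
  · rw [σ₀_degZeroLie]; exact hN _ _ hv
  · rw [map_smul, LinearMap.smul_apply, σ₀_degZeroK]
    exact N.smul_of_tower_mem _ (hN _ _ hv)
  · rw [← sub_eq_of_eq_add' (T.ρ_linear _ v)]
    exact N.sub_mem (hN _ _ hv) (N.sum_mem fun k _ => N.smul_mem _ (hN _ _ hv))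

/-- An `A_n`-submodule that is stable under `ρ` is stable under `σ` if `σ` vanishes in positive
degrees. -/
lemma σ_mem (hσ : ∀ y : geZero g X, (y : Toroidal g X) ∈ filtration g X 1 → T.σ y = 0)
    {N : Submodule (Poly n) M} (hN : ∀ y, ∀ v ∈ N, T.ρ y v ∈ N) (y : geZero g X)
    {v : M} (hv : v ∈ N) : T.σ y v ∈ N := by
  suffices H : ∀ z ∈ filtration g X 0, ∃ h : z ∈ geZero g X, T.σ ⟨z, h⟩ v ∈ N from
    (H y y.2).2
  intro z hz
  unfold filtration at hz
  induction hz using Submodule.iSup_induction' with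
  | zero =>
    refine ⟨(geZero g X).zero_mem, ?_⟩
    change T.σ 0 v ∈ N
    rw [map_zero]; exact N.zero_mem
  | add a b _ _ ha hb =>
    obtain ⟨ha, ha'⟩ := ha
    obtain ⟨hb, hb'⟩ := hb
    refine ⟨(geZero g X).add_mem ha hb, ?_⟩
    change T.σ (⟨a, ha⟩ + ⟨b, hb⟩) v ∈ N
    rw [map_add]; exact N.add_mem ha' hb'
  | mem i a ha =>
    simp only [Nat.zero_le, iSup_pos] at ha
    refine ⟨grade_le_filtration (Nat.zero_le _) ha, ?_⟩
    rcases Nat.eq_zero_or_pos i with rfl | hi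
    · exact T.σ₀_mem hN ⟨a, ha⟩ hv
    · rw [hσ _ (grade_le_filtration hi ha)]
      exact N.zero_mem

/-- An `A_n`-submodule stable under `ρ`, as a submodule for `σ` restricted to `𝔏(𝔤, X_n)_0`. -/
def toLieSubmodule (N : Submodule (Poly n) M) (hN : ∀ y, ∀ v ∈ N, T.ρ y v ∈ N) :
    LieSubmodule ℂ (degZero g X) (RepSpace T.σ₀) :=
  { (N.restrictScalars ℂ : Submodule ℂ M) with
    lie_mem := fun {y v} hv => T.σ₀_mem hN y (v := v) hv }

lemma mem_toLieSubmodule {N : Submodule (Poly n) M} {hN : ∀ y, ∀ v ∈ N, T.ρ y v ∈ N} {v : M} :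
    (show RepSpace T.σ₀ from v) ∈ T.toLieSubmodule N hN ↔ v ∈ N := Iff.rfl

/-- If `N` is not an `A_n`-submodule, some irreducible constituent `V` of `A_n N` meets the core of
`N` trivially: it is found in a complement of the core. -/
lemma exists_irreducible (hcr : ComplementedLattice (LieSubmodule ℂ (degZero g X) (RepSpace T.σ₀)))
    {N : Submodule ℂ M} (hN : T.IsRhoSubmodule N) (h : ¬ ∀ v ∈ N, v ∈ core (n := n) N) :
    ∃ V : LieSubmodule ℂ (degZero g X) (RepSpace T.σ₀), LieModule.IsIrreducible ℂ (degZero g X) V ∧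
      (∀ v : M, (show RepSpace T.σ₀ from v) ∈ V → v ∈ Submodule.span (Poly n) (N : Set M)) ∧
      ∀ v : M, (show RepSpace T.σ₀ from v) ∈ V → v ∈ core (n := n) N → v = 0 := by
  set K := T.toLieSubmodule _ (T.ρ_mem_core hN)
  set H := T.toLieSubmodule _ (T.ρ_mem_span hN)
  obtain ⟨C, hC⟩ := exists_isCompl K
  have hKH : K ≤ H := fun (v : M) hv =>
    T.mem_toLieSubmodule.mpr (Submodule.subset_span (core_le (T.mem_toLieSubmodule.mp hv)))
  have hne : C ⊓ H ≠ ⊥ := by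
    intro h0
    apply h
    have h1 : H = K := by
      calc H = (K ⊔ C) ⊓ H := by rw [hC.sup_eq_top, top_inf_eq]
        _ = K ⊔ C ⊓ H := sup_inf_assoc_of_le C hKH
        _ = K := by rw [h0, sup_bot_eq]
    intro v hv
    have h2 : (show RepSpace T.σ₀ from v) ∈ H :=
      T.mem_toLieSubmodule.mpr (Submodule.subset_span hv)
    rw [h1] at h2
    exact h2
  obtain ⟨V, hV, hVle⟩ := (eq_bot_or_exists_atom_le (C ⊓ H)).resolve_left hne
  refine ⟨V, ?_, fun v hv => (le_inf_iff.mp hVle).2 hv, fun v hv hvK => ?_⟩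
  · have := hV.1
    have : Nontrivial V := (LieSubmodule.nontrivial_iff_ne_bot ℂ (degZero g X) _).mpr hV.1
    refine LieModule.IsIrreducible.mk fun W hW => ?_
    have h1 : W.map V.incl ≤ V := by
      rintro x ⟨w, -, rfl⟩
      exact w.2
    rcases hV.le_iff.mp h1 with h2 | h2
    · refine absurd ((LieSubmodule.eq_bot_iff _).mpr fun w hw => ?_) hW
      have h3 : (w : RepSpace T.σ₀) ∈ W.map V.incl := ⟨w, hw, rfl⟩
      rw [h2] at h3
      exact Subtype.ext h3
    · rw [eq_top_iff]
      intro x _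
      have : (x : RepSpace T.σ₀) ∈ W.map V.incl := by rw [h2]; exact x.2
      obtain ⟨w, hw, hwx⟩ := this
      rwa [← Subtype.ext hwx]
  · have : (show RepSpace T.σ₀ from v) ∈ C ⊓ K := ⟨(le_inf_iff.mp hVle).1 hv, hvK⟩
    rw [hC.symm.inf_eq_bot] at this
    exact this

/-- `𝔤` and the `K_j` map `N` to its core, since `f σ(x) = ρ(x ⊗ f)` and `f σ(K_j) = ρ(f K_j)`. -/
lemma σ₀_mem_core {N : Submodule ℂ M} (hN : T.IsRhoSubmodule N) {y : degZero g X}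
    (hy : (y : Toroidal g X).right = 0) {v : M} (hv : v ∈ N) : T.σ₀ y v ∈ core (n := n) N := by
  obtain ⟨x, c, hyd⟩ := exists_degZero_decomposition y
  have h0 : (⟨(y : Toroidal g X).right, (y : Toroidal g X).right.2, y.2.2.2⟩ : linearFields X)
      = 0 := Subtype.ext (by simp [hy])
  rw [h0, map_zero, add_zero] at hyd
  rw [hyd, map_add, map_sum, LinearMap.add_apply, LinearMap.sum_apply]
  refine Submodule.add_mem _ (fun f => ?_) (Submodule.sum_mem _ fun j _ => ?_)
  · rw [← σ₀_smul]
    change T.σ (geZeroOfLie X x) (f • v) ∈ N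
    rw [← T.ρ_lie]
    exact hN _ _ hv
  · rw [map_smul, LinearMap.smul_apply]
    refine Submodule.smul_of_tower_mem _ _ fun f => ?_
    rw [← σ₀_smul]
    change T.σ (geZeroK g X j) (f • v) ∈ N
    rw [← T.ρ_K]
    exact hN _ _ hv

end ToroidalModule

/-! ### Brackets of linear vector fields -/

section Brackets

variable {n : ℕ}

lemma diagonal_apply_t (c : Fin n → ℂ) (k : Fin n) : diagonal c (t k) = c k • t k := by
  simp only [diagonal, witt_sum_apply, Derivation.smul_apply, d_t, smul_eq_mul, mul_ite, mul_one,
    mul_zero, Finset.sum_ite_eq', Finset.mem_univ, if_true]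

lemma lie_t_smul_d (i j k l : Fin n) : ⁅(t i • d j : Witt n), (t k • d l : Witt n)⁆
    = (if j = k then (t i • d l : Witt n) else 0) - if l = i then (t k • d j : Witt n) else 0 := by
  apply MvPolynomial.derivation_ext
  intro a
  rw [Derivation.commutator_apply]
  change _ = (if j = k then (t i • d l : Witt n) else 0) (t a)
    - (if l = i then (t k • d j : Witt n) else 0) (t a)
  have e : ∀ (p : Prop) [Decidable p] (D : Witt n) (f : Poly n),
      (if p then D else 0) f = if p then D f else 0 := by
    intro p _ D f; split_ifs <;> rfl
  simp only [e, Derivation.smul_apply, smul_eq_mul, d_t, mul_ite, mul_one,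
    mul_zero, apply_ite (d _), map_zero]
  split_ifs <;> simp

lemma lie_diagonal (c : Fin n → ℂ) (i j : Fin n) :
    ⁅diagonal c, (t i • d j : Witt n)⁆ = (c i - c j) • (t i • d j : Witt n) := by
  apply MvPolynomial.derivation_ext
  intro a
  rw [Derivation.commutator_apply]
  change _ = (c i - c j) • (t i * d j (t a))
  simp only [Derivation.smul_apply, Derivation.leibniz, smul_eq_mul, diagonal_apply_t, d_t,
    Derivation.map_smul, apply_ite (diagonal c), Derivation.map_one_eq_zero, map_zero, ite_self]
  split_ifs with h
  · subst h; simp; module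
  · simp

lemma lie_diagonal_diagonal (c e : Fin n → ℂ) : ⁅diagonal c, diagonal e⁆ = 0 := by
  apply MvPolynomial.derivation_ext
  intro a
  rw [Derivation.commutator_apply]
  simp only [diagonal_apply_t, Derivation.map_smul, smul_comm (c a), sub_self]
  rfl

lemma diagonal_sum {ι : Type*} [Fintype ι] (a : ι → ℂ) (c : ι → Fin n → ℂ) :
    diagonal (fun i => ∑ k, a k * c k i) = ∑ k, a k • diagonal (c k) := by
  apply MvPolynomial.derivation_ext
  intro i
  simp only [witt_sum_apply, diagonal_apply_t, Derivation.smul_apply, Finset.sum_smul, smul_smul]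

end Brackets

/-! ### Dominance of highest weights -/

section Weights

variable {V : Type*} [AddCommGroup V] [Module ℂ V]

/-- If `f² = 0` in a representation of `𝔰𝔩₂`, then the highest weights are `0` and `1`, because
`0 = e f² v = 2 (c - 1) f v` and `e f v = c v`. -/
lemma sl2_highest_weight {e f h : Module.End ℂ V} (hef : e * f - f * e = h)
    (hhf : h * f - f * h = (-2 : ℂ) • f) (hf : f * f = 0) {v : V} (hv : v ≠ 0) {c : ℤ}
    (hev : e v = 0) (hhv : h v = (c : ℂ) • v) : c = 0 ∨ c = 1 := by
  have h1 : ∀ w, e (f w) = f (e w) + h w := fun w => by rw [← hef]; simp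
  have h2 : ∀ w, h (f w) = f (h w) + (-2 : ℂ) • f w := fun w => by
    have := congrArg (fun T : Module.End ℂ V => T w) hhf
    simp only [LinearMap.sub_apply, Module.End.mul_apply, LinearMap.smul_apply] at this
    rw [← this]; abel
  have h3 : f (f v) = 0 := by rw [← Module.End.mul_apply, hf]; rfl
  have h4 : e (f (f v)) = (2 * ((c : ℂ) - 1)) • f v := by
    rw [h1, h1, h2, hev, hhv]; simp only [map_zero, zero_add, map_smul]; module
  rw [h3, map_zero] at h4
  rcases smul_eq_zero.mp h4.symm with h5 | h5
  · right
    have h6 : (c : ℂ) = 1 := by linear_combination h5 / 2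
    exact_mod_cast h6
  · left
    have h6 := h1 v
    rw [h5, hev, hhv, map_zero, map_zero, zero_add] at h6
    exact_mod_cast (smul_eq_zero.mp h6.symm).resolve_right hv

/-- If `f` raises the `h'`-weight, it kills the `h'`-weight space of weight `1`, because `2` is not
an eigenvalue of `h'`. This forces the highest weight to be dominant. -/
lemma weight_eq_one {e f h h' : Module.End ℂ V} (hef : e * f - f * e = h - h')
    (hhf : h' * f - f * h' = f) (hcube : h' * h' * h' = h') {v : V} (hv : v ≠ 0) {c c' : ℤ}
    (hev : e v = 0) (hhv : h v = (c : ℂ) • v) (hhv' : h' v = (c' : ℂ) • v) (hc : c' = 1) :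
    c = 1 := by
  subst hc
  have h2 : h' (f v) = ((2 : ℤ) : ℂ) • f v := by
    have := congrArg (fun T : Module.End ℂ V => T v) hhf
    simp only [LinearMap.sub_apply, Module.End.mul_apply, hhv', map_smul] at this
    rw [eq_add_of_sub_eq this]; push_cast; module
  have h3 : f v = 0 := by
    by_contra h0
    have := eigenvalue_of_cube hcube h0 h2
    omega
  have h4 := congrArg (fun T : Module.End ℂ V => T v) hef
  simp only [LinearMap.sub_apply, Module.End.mul_apply, h3, hev, hhv, hhv', map_zero, sub_zero,
    ← sub_smul] at h4
  have h5 := (smul_eq_zero.mp h4.symm).resolve_right hv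
  have h6 : (c : ℂ) = (1 : ℤ) := sub_eq_zero.mp h5
  exact_mod_cast h6

/-- A decreasing sequence of zeros and ones is `1, …, 1, 0, …, 0`. -/
lemma exists_threshold {m : ℕ} (l : Fin m → ℤ) (h01 : ∀ i, l i = 0 ∨ l i = 1)
    (hanti : ∀ i j, i < j → l j = 1 → l i = 1) :
    ∃ k ≤ m, ∀ i : Fin m, l i = if (i : ℕ) < k then 1 else 0 := by
  classical
  have hex : ∃ k, m ≤ k ∨ ∃ i : Fin m, (i : ℕ) = k ∧ l i = 0 := ⟨m, Or.inl le_rfl⟩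
  refine ⟨Nat.find hex, Nat.find_min' hex (Or.inl le_rfl), fun i => ?_⟩
  split_ifs with h
  · have := Nat.find_min hex h
    push Not at this
    exact (h01 i).resolve_left (this.2 i rfl)
  · push Not at h
    rcases Nat.find_spec hex with h1 | ⟨j, hj, hj0⟩
    · have := i.2; omega
    · rcases eq_or_lt_of_le h with h2 | h2
      · rwa [← Fin.ext (hj.trans h2)]
      · refine (h01 i).resolve_right fun h3 => ?_
        have := hanti j i (by rw [Fin.lt_def]; omega) h3
        omega

end Weights

section Exceptional

variable {n : ℕ} {g : Type*} [LieRing g] [LieAlgebra ℂ g] {X : Series n}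
  {V : Type*} [AddCommGroup V] [Module ℂ V] [LieRingModule (degZero g X) V]
  [LieModule ℂ (degZero g X) V]

variable (g V) in
/-- The action of the linear vector fields of `X_n` on an `𝔏(𝔤, X_n)_0`-module. -/
def fieldAct : linearFields X →ₗ[ℂ] Module.End ℂ V :=
  (LieModule.toEnd ℂ (degZero g X) V : degZero g X →ₗ[ℂ] Module.End ℂ V) ∘ₗ degZeroField g X

lemma fieldAct_lie {D E F : linearFields X} (h : ⁅(D : Witt n), (E : Witt n)⁆ = F) :
    fieldAct g V D * fieldAct g V E - fieldAct g V E * fieldAct g V D = fieldAct g V F := by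
  change _ = LieModule.toEnd ℂ (degZero g X) V (degZeroField g X F)
  rw [← lie_degZeroField h, LieHom.map_lie, LieRing.of_associative_ring_bracket]
  rfl

lemma fieldAct_lie_smul {D E : linearFields X} {c : ℂ}
    (h : ⁅(D : Witt n), (E : Witt n)⁆ = c • (E : Witt n)) :
    fieldAct g V D * fieldAct g V E - fieldAct g V E * fieldAct g V D = c • fieldAct g V E := by
  rw [fieldAct_lie (F := c • E) h, map_smul]

lemma fieldAct_sub (D E : linearFields X) :
    fieldAct g V (D - E) = fieldAct g V D - fieldAct g V E := by
  have h : D - E + E = D := Subtype.ext (sub_add_cancel (D : Witt n) E)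
  rw [eq_sub_iff_add_eq, ← map_add, h]

lemma fieldAct_diagonal_comm {c e : Fin n → ℂ} (hc : diagonal c ∈ linearFields X)
    (he : diagonal e ∈ linearFields X) :
    fieldAct g V ⟨_, hc⟩ * fieldAct g V ⟨_, he⟩ = fieldAct g V ⟨_, he⟩ * fieldAct g V ⟨_, hc⟩ := by
  have h := fieldAct_lie (g := g) (V := V) (D := ⟨_, hc⟩) (E := ⟨_, he⟩) (F := 0)
    (lie_diagonal_diagonal c e)
  rwa [map_zero, sub_eq_zero] at h

/-- Exceptionality in terms of the action of linear vector fields only. -/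
lemma isExceptional_of_highest_weight (hirr : LieModule.IsIrreducible ℂ (degZero g X) V)
    (hcur : ∀ y : degZero g X, (y : Toroidal g X).right = 0 → ∀ v : V, ⁅y, v⁆ = 0) {k : ℕ} {v : V}
    (hv : v ≠ 0)
    (hpos : ∀ D : linearFields X, (D : Witt n) ∈ positiveRootVectors X → fieldAct g V D v = 0)
    (hdiag : ∀ (D : linearFields X) (c : Fin n → ℂ), (D : Witt n) = diagonal c →
      fieldAct g V D v = fundamentalWeight k c • v) : IsExceptional g X k V := by
  refine ⟨hirr, hcur, v, hv, fun y hy hr => ?_, fun y c hy hr => ?_⟩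
  · rw [eq_degZeroField hy]; exact hpos _ hr
  · rw [eq_degZeroField hy]; exact hdiag _ c hr

lemma fieldAct_sum_apply {ι : Type*} [Fintype ι] {H : ι → linearFields X} {l : ι → ℤ} {v : V}
    (hl : ∀ i, fieldAct g V (H i) v = (l i : ℂ) • v) {D : linearFields X} {a : ι → ℂ}
    (hD : (D : Witt n) = ∑ i, a i • (H i : Witt n)) :
    fieldAct g V D v = (∑ i, a i * l i) • v := by
  have h : D = ∑ i, a i • H i := Subtype.ext (by
    rw [hD]
    change _ = (linearFields X).subtype (∑ i, a i • H i)
    simp)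
  rw [h, map_sum, LinearMap.sum_apply, Finset.sum_smul]
  exact Finset.sum_congr rfl fun i _ => by rw [map_smul, LinearMap.smul_apply, hl, smul_smul]

end Exceptional

/-! ### Exceptional modules for the Witt series -/

section SeriesW

variable {n : ℕ} {g : Type*} [LieRing g] [LieAlgebra ℂ g]
  {V : Type*} [AddCommGroup V] [Module ℂ V] [LieRingModule (degZero g (.W : Series n)) V]
  [LieModule ℂ (degZero g (.W : Series n)) V]

lemma diagonal_single (k : Fin n) : diagonal (Pi.single k 1) = (t k • d k : Witt n) := by
  apply MvPolynomial.derivation_ext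
  intro i
  simp only [diagonal_apply_t, Derivation.smul_apply, d_t, Pi.single_apply]
  by_cases h : i = k
  · subst h; simp
  · simp [h, Ne.symm h]

/-- The field `t_i d_j` as an element of `(W_n)_0`. -/
def fieldW (i j : Fin n) : linearFields (.W : Series n) :=
  ⟨t i • d j, LieSubalgebra.mem_top _, linear_W i j⟩

/-- An irreducible module killed by `𝔤` and the `K_j` is exceptional if each `t_i d_i` acts as an
idempotent. -/
lemma exists_isExceptional_W (hirr : LieModule.IsIrreducible ℂ (degZero g (.W : Series n)) V)
    (hcur : ∀ y : degZero g (.W : Series n), (y : Toroidal g (.W : Series n)).right = 0 →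
      ∀ v : V, ⁅y, v⁆ = 0)
    (hsq : ∀ i : Fin n, fieldAct g V (fieldW i i) * fieldAct g V (fieldW i i)
      = fieldAct g V (fieldW i i)) :
    ∃ k ≤ n, IsExceptional g (.W : Series n) k V := by
  have := LieModule.nontrivial_of_isIrreducible ℂ (degZero g (.W : Series n)) V
  set E : Fin n → Fin n → Module.End ℂ V := fun i j => fieldAct g V (fieldW i j)
  have hroot : ∀ k i j, E k k * E i j - E i j * E k k
      = (((Pi.single k 1 : Fin n → ℤ) i - (Pi.single k 1 : Fin n → ℤ) j : ℤ) : ℂ) • E i j := by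
    intro k i j
    refine fieldAct_lie_smul ?_
    change ⁅(t k • d k : Witt n), (t i • d j : Witt n)⁆ = _ • (t i • d j : Witt n)
    rw [← diagonal_single, lie_diagonal]
    congr 1
    simp only [Pi.single_apply]
    push_cast
    rfl
  have hcomm : ∀ i j, E i i * E j j = E j j * E i i := fun i j => by
    rw [← sub_eq_zero, hroot i j j, sub_self]; simp
  have hcube : ∀ i, E i i * E i i * E i i = E i i := fun i => by rw [hsq, hsq]
  -- any strictly decreasing coefficients give the roots `ε_i - ε_j`, `i < j`, positive height
  obtain ⟨v, hv, l, hl, hmax⟩ := exists_highest (fun i => E i i) hcomm hcube (fun i => -(i : ℤ))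
  have hpos : ∀ i j, i < j → E i j v = 0 := by
    intro i j hij
    refine hmax _ _ (fun k => hroot k i j) ?_
    simp only [mul_sub, Finset.sum_sub_distrib, Pi.single_apply, mul_ite, mul_one, mul_zero,
      Finset.sum_ite_eq, Finset.mem_univ, if_true]
    have : (i : ℕ) < j := hij
    omega
  have h01 : ∀ i, l i = 0 ∨ l i = 1 := by
    intro i
    have h1 := congrArg (fun T : Module.End ℂ V => T v) (hsq i)
    have h2 : (l i : ℂ) * l i = l i := by
      simp only [Module.End.mul_apply] at h1
      change E i i (E i i v) = E i i v at h1
      rw [hl, map_smul, hl, smul_smul] at h1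
      exact smul_left_injective ℂ hv h1
    have h3 : l i * l i = l i := by exact_mod_cast h2
    have h4 : l i * (l i - 1) = 0 := by linear_combination h3
    rcases mul_eq_zero.mp h4 with h | h <;> omega
  have hanti : ∀ i j, i < j → l j = 1 → l i = 1 := by
    intro i j hij
    refine weight_eq_one (e := E i j) (f := E j i) ?_ ?_ (hcube j) hv (hpos i j hij) (hl i) (hl j)
    · rw [← map_sub]
      refine fieldAct_lie ?_
      change ⁅(t i • d j : Witt n), (t j • d i : Witt n)⁆
        = (t i • d i : Witt n) - (t j • d j : Witt n)
      rw [lie_t_smul_d, if_pos rfl, if_pos rfl]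
    · rw [hroot]; simp [hij.ne]
  obtain ⟨k, hk, hlk⟩ := exists_threshold l h01 hanti
  refine ⟨k, hk, isExceptional_of_highest_weight hirr hcur hv ?_ fun D c hD => ?_⟩
  · rintro ⟨D, hD⟩ ⟨i, j, hij, rfl⟩
    exact hpos i j hij
  · rw [fieldAct_sum_apply (a := c) hl (by simp [hD, diagonal, fieldW, smul_assoc])]
    simp [fundamentalWeight, hlk]

end SeriesW

lemma diagonal_homogeneous {n : ℕ} (c : Fin n → ℂ) (k : Fin n) :
    (diagonal c (t k)).IsHomogeneous 1 := by
  rw [diagonal_apply_t]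
  exact (MvPolynomial.homogeneousSubmodule (Fin n) ℂ 1).smul_mem _
    (MvPolynomial.isHomogeneous_X _ _)

lemma diagonal_sub {n : ℕ} (c e : Fin n → ℂ) : diagonal (c - e) = diagonal c - diagonal e := by
  apply MvPolynomial.derivation_ext
  intro k
  change _ = diagonal c (t k) - diagonal e (t k)
  simp only [diagonal_apply_t, Pi.sub_apply, sub_smul]

lemma witt_lie_add {n : ℕ} (D E F : Witt n) : ⁅D, E + F⁆ = ⁅D, E⁆ + ⁅D, F⁆ := lie_add D E F

lemma witt_lie_sub {n : ℕ} (D E F : Witt n) : ⁅D, E - F⁆ = ⁅D, E⁆ - ⁅D, F⁆ := lie_sub D E F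

lemma witt_sub_lie {n : ℕ} (D E F : Witt n) : ⁅D - E, F⁆ = ⁅D, F⁆ - ⁅E, F⁆ := sub_lie D E F

lemma witt_lie_smul {n : ℕ} (c : ℂ) (D E : Witt n) : ⁅D, c • E⁆ = c • ⁅D, E⁆ := lie_smul c D E

lemma witt_smul_lie {n : ℕ} (c : ℂ) (D E : Witt n) : ⁅c • D, E⁆ = c • ⁅D, E⁆ := smul_lie c D E

lemma diagonal_single_sub {n : ℕ} (i j : Fin n) :
    diagonal (Pi.single i 1 - Pi.single j 1) = (t i • d i - t j • d j : Witt n) := by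
  rw [diagonal_sub, diagonal_single, diagonal_single]

/-! ### Exceptional modules for the special series -/

section SeriesS

variable {n : ℕ} {g : Type*} [LieRing g] [LieAlgebra ℂ g]
  {V : Type*} [AddCommGroup V] [Module ℂ V] [LieRingModule (degZero g (.S : Series n)) V]
  [LieModule ℂ (degZero g (.S : Series n)) V]

/-- The field `t_i d_j`, `i ≠ j`, as an element of `(S_n)_0`. -/
def fieldS {i j : Fin n} (h : i ≠ j) : linearFields (.S : Series n) :=
  ⟨t i • d j, by
    rw [t_smul_d_eq_dS h]
    exact Submodule.smul_mem _ _ ⟨dS_mem i j _, linear_S i j i i⟩⟩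

lemma divergence_diagonal (c : Fin n → ℂ) :
    divergence (diagonal c) = MvPolynomial.C (∑ i, c i) := by
  simp only [divergence, diagonal_apply_t, Derivation.map_smul, d_t, if_true, map_sum]
  simp only [MvPolynomial.smul_eq_C_mul, mul_one]

/-- The field `t_i d_i - t_j d_j` as an element of `(S_n)_0`. -/
def cartanS (i j : Fin n) : linearFields (.S : Series n) :=
  ⟨diagonal (Pi.single i 1 - Pi.single j 1), by
    change divergence _ = 0
    rw [divergence_diagonal]
    simp, diagonal_homogeneous _⟩

/-- An irreducible module killed by `𝔤` and the `K_j` is exceptional if each `t_i d_j`, `i ≠ j`,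
acts with square zero. -/
lemma exists_isExceptional_S (hn : 2 ≤ n)
    (hirr : LieModule.IsIrreducible ℂ (degZero g (.S : Series n)) V)
    (hcur : ∀ y : degZero g (.S : Series n), (y : Toroidal g (.S : Series n)).right = 0 →
      ∀ v : V, ⁅y, v⁆ = 0)
    (hsq : ∀ (i j : Fin n) (h : i ≠ j), fieldAct g V (fieldS h) * fieldAct g V (fieldS h) = 0) :
    ∃ k ≤ n - 1, IsExceptional g (.S : Series n) k V := by
  have := LieModule.nontrivial_of_isIrreducible ℂ (degZero g (.S : Series n)) V
  set H : Fin n → Fin n → Module.End ℂ V := fun i j => fieldAct g V (cartanS i j) with hH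
  have hroot : ∀ (a b i j : Fin n) (h : i ≠ j),
      H a b * fieldAct g V (fieldS h) - fieldAct g V (fieldS h) * H a b
        = (((Pi.single a 1 - Pi.single b 1 : Fin n → ℤ) i
          - (Pi.single a 1 - Pi.single b 1 : Fin n → ℤ) j : ℤ) : ℂ) • fieldAct g V (fieldS h) := by
    intro a b i j h
    refine fieldAct_lie_smul ((lie_diagonal _ i j).trans ?_)
    congr 1
    simp only [Pi.sub_apply, Pi.single_apply]
    push_cast
    rfl
  have hbr : ∀ (i j : Fin n) (h : i ≠ j), fieldAct g V (fieldS h) * fieldAct g V (fieldS h.symm)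
      - fieldAct g V (fieldS h.symm) * fieldAct g V (fieldS h) = H i j := by
    intro i j h
    refine fieldAct_lie ?_
    change ⁅(t i • d j : Witt n), (t j • d i : Witt n)⁆ = diagonal _
    rw [lie_t_smul_d, if_pos rfl, if_pos rfl, diagonal_single_sub]
  have hself : ∀ i, H i i = 0 := fun i => by
    have : cartanS i i = 0 := Subtype.ext (by
      change diagonal _ = 0
      rw [diagonal_single_sub, sub_self])
    simp only [hH, this, map_zero]
  have hcube : ∀ i j, H i j * H i j * H i j = H i j := by
    intro i j
    rcases eq_or_ne i j with rfl | h
    · rw [hself]; simp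
    · refine sl2_cube (hbr i j h) ?_ ?_ (hsq i j h) (hsq j i h.symm)
      · rw [hroot i j i j h, two_smul, ← two_smul ℂ]
        congr 1
        simp [h, h.symm]
      · rw [hroot i j j i h.symm, two_smul, ← two_smul ℂ, ← neg_smul]
        congr 1
        simp [h, h.symm]
  -- the weights are normalized to vanish on the last coordinate
  let last : Fin n := ⟨n - 1, by omega⟩
  obtain ⟨v, hv, l, hl, hmax⟩ := exists_highest (fun i => H i last)
    (fun i j => fieldAct_diagonal_comm _ _) (fun i => hcube i last) (fun i => (n : ℤ) - i)
  have hpos : ∀ (i j : Fin n) (h : i < j), fieldAct g V (fieldS h.ne) v = 0 := by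
    intro i j h
    refine hmax _ _ (fun k => hroot k last i j h.ne) ?_
    have hi : i ≠ last := by
      intro e
      have h1 : (i : ℕ) = n - 1 := congrArg Fin.val e
      have h2 : (i : ℕ) < j := h
      have := j.2
      omega
    have h0 : 0 ≤ ∑ k : Fin n, ((n : ℤ) - k) := Finset.sum_nonneg fun k _ => by
      have := k.2; omega
    -- the root of `t_i d_j`, evaluated on `t_k d_k - t_last d_last`
    have h1 : ∀ k : Fin n, ((n : ℤ) - k) * ((Pi.single k 1 - Pi.single last 1 : Fin n → ℤ) i
        - (Pi.single k 1 - Pi.single last 1 : Fin n → ℤ) j)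
        = (if i = k then (n : ℤ) - k else 0) - (if j = k then (n : ℤ) - k else 0)
          + (if j = last then (n : ℤ) - k else 0) := by
      intro k
      simp only [Pi.sub_apply, Pi.single_apply, if_neg hi]
      split_ifs <;> ring
    simp only [h1, Finset.sum_add_distrib, Finset.sum_sub_distrib, Finset.sum_ite_eq,
      Finset.mem_univ, if_true]
    have h2 : (i : ℕ) < j := h
    split_ifs
    · omega
    · simp only [Finset.sum_const_zero]; omega
  have hlast : l last = 0 := by
    have h1 := hl last
    rw [hself] at h1
    exact_mod_cast (smul_eq_zero.mp h1.symm).resolve_right hv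
  have hdiff : ∀ i j, i < j → l i - l j = 0 ∨ l i - l j = 1 := by
    intro i j h
    refine sl2_highest_weight (hbr i j h.ne) ?_ (hsq j i h.ne') hv (hpos i j h) ?_
    · rw [hroot i j j i h.ne']
      congr 1
      simp [h.ne, h.ne']
    · have h1 : cartanS i j = cartanS i last - cartanS j last := Subtype.ext (by
        change diagonal _ = diagonal _ - diagonal _
        simp only [diagonal_single_sub]; abel)
      have h2 : H i j = H i last - H j last := by rw [← fieldAct_sub, ← h1]
      rw [h2, LinearMap.sub_apply, hl, hl, ← sub_smul]; push_cast; rfl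
  have h01 : ∀ i, l i = 0 ∨ l i = 1 := by
    intro i
    rcases eq_or_ne i last with rfl | h
    · exact Or.inl hlast
    · have h1 := hdiff i last (lt_of_le_of_ne (Fin.le_def.mpr (by
        have := i.2; change (i : ℕ) ≤ n - 1; omega)) h)
      rwa [hlast, sub_zero] at h1
  obtain ⟨k, hk, hlk⟩ := exists_threshold l h01 fun i j hij h1 => by
    have := hdiff i j hij
    have := h01 i
    omega
  have hk' : k ≤ n - 1 := by
    by_contra h
    have h1 := hlk last
    rw [hlast, if_pos (by change n - 1 < k; omega)] at h1
    omega
  refine ⟨k, hk', isExceptional_of_highest_weight hirr hcur hv ?_ fun D c hD => ?_⟩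
  · rintro ⟨D, hD⟩ ⟨i, j, hij, rfl⟩
    exact hpos i j hij
  · have htr : ∑ i, c i = 0 := by
      have h1 : divergence (D : Witt n) = 0 := D.2.1
      rw [hD, divergence_diagonal] at h1
      exact MvPolynomial.C_eq_zero.mp h1
    have hc : (D : Witt n) = ∑ i, c i • (cartanS i last : Witt n) := by
      change _ = ∑ i, c i • diagonal (Pi.single i 1 - Pi.single last 1)
      rw [hD, ← diagonal_sum]
      congr 1
      funext a
      simp only [Pi.sub_apply, mul_sub, Finset.sum_sub_distrib, ← Finset.sum_mul, htr, zero_mul,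
        sub_zero, Pi.single_apply]
      simp
    rw [fieldAct_sum_apply hl hc]
    simp [fundamentalWeight, hlk]

end SeriesS

/-! ### Exceptional modules for the Hamiltonian series -/

section SeriesH

variable {n m : ℕ} (hm : n = 2 * m)

/-- The index `k`, counted from `0`, in the first half of the coordinates of `ℂ^{2m}`. -/
def fstHalf (k : Fin m) : Fin n := ⟨k, by have := k.2; omega⟩

/-- The index `k + m` in the second half of the coordinates of `ℂ^{2m}`. -/
def sndHalf (k : Fin m) : Fin n := ⟨k + m, by have := k.2; omega⟩

lemma fstHalf_inj {i j : Fin m} : fstHalf hm i = fstHalf hm j ↔ i = j := by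
  simp [fstHalf, Fin.ext_iff]

lemma sndHalf_inj {i j : Fin m} : sndHalf hm i = sndHalf hm j ↔ i = j := by
  simp [sndHalf, Fin.ext_iff]

lemma fstHalf_ne_sndHalf (i j : Fin m) : fstHalf hm i ≠ sndHalf hm j := by
  intro h
  have h1 : (i : ℕ) = j + m := congrArg Fin.val h
  have := i.2
  omega

lemma sndHalf_ne_fstHalf (i j : Fin m) : sndHalf hm i ≠ fstHalf hm j :=
  (fstHalf_ne_sndHalf hm j i).symm

lemma exists_half (a : Fin n) : (∃ k, a = fstHalf hm k) ∨ ∃ k, a = sndHalf hm k := by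
  by_cases h : (a : ℕ) < m
  · exact Or.inl ⟨⟨a, h⟩, rfl⟩
  · refine Or.inr ⟨⟨a - m, by have := a.2; omega⟩, Fin.ext ?_⟩
    change (a : ℕ) = a - m + m
    omega

lemma dH_t_mul_t (a b : Fin n) : dH m (t a * t b)
    = t b • ∑ c, sympl m a c • d c + t a • ∑ c, (sympl m b c • d c : Witt n) := by
  have h : ∀ x c : Fin n, (sympl m x c • d x (t a * t b)) • (d c : Witt n)
      = (if x = a then t b • sympl m a c • d c else 0)
        + if x = b then t a • sympl m b c • d c else 0 := by
    intro x c
    simp only [Derivation.leibniz, d_t, smul_eq_mul, mul_ite, mul_one, mul_zero]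
    split_ifs with h1 h2 h2
    · subst h1; subst h2
      simp only [smul_add, add_smul, smul_assoc, smul_comm (sympl m x c)]
    · subst h1
      simp only [add_zero, zero_add, smul_assoc, smul_comm (sympl m x c)]
    · subst h2
      simp only [add_zero, zero_add, smul_assoc, smul_comm (sympl m x c)]
    · simp
  simp only [dH, h, Finset.sum_add_distrib, Finset.smul_sum]
  rw [Finset.sum_comm, Finset.sum_comm (f := fun x c => if x = b then _ else _)]
  simp

lemma sum_sympl_fstHalf (k : Fin m) :
    ∑ c, sympl m (fstHalf hm k) c • (d c : Witt n) = d (sndHalf hm k) := by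
  rw [Finset.sum_eq_single (sndHalf hm k)]
  · simp [sympl, fstHalf, sndHalf]
  · intro c _ hc
    have h1 : (c : ℕ) ≠ k + m := fun h => hc (Fin.ext h)
    have h2 : (k : ℕ) ≠ c + m := by have := k.2; omega
    simp [sympl, fstHalf, h1, h2]
  · simp

lemma sum_sympl_sndHalf (k : Fin m) :
    ∑ c, sympl m (sndHalf hm k) c • (d c : Witt n) = -d (fstHalf hm k) := by
  rw [Finset.sum_eq_single (fstHalf hm k)]
  · have h1 : (k : ℕ) ≠ k + m + m := by have := k.2; omega
    simp only [sympl, fstHalf, sndHalf, if_neg h1, if_true]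
    exact neg_one_smul ℂ (d _ : Witt n)
  · intro c _ hc
    have h1 : (c : ℕ) ≠ k + m + m := by have := c.2; omega
    have h2 : (k : ℕ) ≠ c := fun h => hc (Fin.ext h.symm)
    simp [sympl, sndHalf, h1, h2]
  · simp

lemma dH_fstHalf_fstHalf (i j : Fin m) : dH m (t (fstHalf hm i) * t (fstHalf hm j))
    = (t (fstHalf hm i) • d (sndHalf hm j) + t (fstHalf hm j) • d (sndHalf hm i) : Witt n) := by
  rw [dH_t_mul_t, sum_sympl_fstHalf, sum_sympl_fstHalf, add_comm]

lemma dH_fstHalf_sndHalf (i j : Fin m) : -dH m (t (fstHalf hm i) * t (sndHalf hm j))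
    = (t (fstHalf hm i) • d (fstHalf hm j) - t (sndHalf hm j) • d (sndHalf hm i) : Witt n) := by
  rw [dH_t_mul_t, sum_sympl_fstHalf, sum_sympl_sndHalf, smul_neg]; abel

lemma dH_sndHalf_sndHalf (i : Fin m) : dH m (t (sndHalf hm i) * t (sndHalf hm i))
    = (-2 : ℂ) • (t (sndHalf hm i) • d (fstHalf hm i) : Witt n) := by
  rw [dH_t_mul_t, sum_sympl_sndHalf, smul_neg]
  refine Derivation.ext fun f => ?_
  simp only [Derivation.add_apply, Derivation.neg_apply, Derivation.smul_apply, smul_eq_mul,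
    MvPolynomial.smul_eq_C_mul, map_neg, map_ofNat]
  ring

/-- `d_H(t_a t_b)` as an element of `(H_n)_0`. -/
def fieldH (a b : Fin n) : linearFields (.H m hm) := ⟨dH m (t a * t b), dH_mem hm _, linear_H m a b⟩

variable {g : Type*} [LieRing g] [LieAlgebra ℂ g]
  {V : Type*} [AddCommGroup V] [Module ℂ V] [LieRingModule (degZero g (.H m hm : Series n)) V]
  [LieModule ℂ (degZero g (.H m hm : Series n)) V]

/-- The coefficients of the diagonal field `t_k d_k - t_{k+m} d_{k+m}`. -/
def cartanCoeff (k : Fin m) : Fin n → ℂ := Pi.single (fstHalf hm k) 1 - Pi.single (sndHalf hm k) 1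

lemma cartanCoeff_fstHalf (k i : Fin m) :
    cartanCoeff hm k (fstHalf hm i) = ((Pi.single k 1 : Fin m → ℤ) i : ℂ) := by
  simp only [cartanCoeff, Pi.sub_apply, Pi.single_apply, fstHalf_inj, fstHalf_ne_sndHalf, if_false,
    sub_zero]
  push_cast; rfl

lemma cartanCoeff_sndHalf (k i : Fin m) :
    cartanCoeff hm k (sndHalf hm i) = -((Pi.single k 1 : Fin m → ℤ) i : ℂ) := by
  simp only [cartanCoeff, Pi.sub_apply, Pi.single_apply, sndHalf_inj, sndHalf_ne_fstHalf, if_false,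
    zero_sub]
  push_cast; rfl

/-- `t_k d_k - t_{k+m} d_{k+m}` as an element of `(H_n)_0`. -/
def cartanH (k : Fin m) : linearFields (.H m hm) := ⟨diagonal (cartanCoeff hm k), by
  have h : diagonal (cartanCoeff hm k) = ((-fieldH hm (fstHalf hm k) (sndHalf hm k) :
      linearFields (.H m hm)) : Witt n) := by
    rw [cartanCoeff, diagonal_single_sub]
    exact (dH_fstHalf_sndHalf hm k k).symm
  rw [h]
  exact Subtype.property _⟩

lemma coeff_of_diagonal_mem {c : Fin n → ℂ} (h : diagonal c ∈ hamiltonianAlgebra n m) (k : Fin m) :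
    c (sndHalf hm k) = -c (fstHalf hm k) := by
  have h1 := h (fstHalf hm k) (sndHalf hm k)
  have hs : sympl m (fstHalf hm k) (sndHalf hm k) = 1 := by simp [sympl, fstHalf, sndHalf]
  simp only [lieDerivSympl, diagonal_apply_t, Derivation.map_smul, d_t, smul_ite, smul_zero,
    Finset.sum_add_distrib, Finset.sum_ite_eq, Finset.mem_univ, if_true, hs, one_smul,
    MvPolynomial.smul_eq_C_mul (1 : Poly n), mul_one, ← map_add] at h1
  have h2 := MvPolynomial.C_eq_zero.mp h1
  linear_combination h2

lemma fundamentalWeight_eq {k : ℕ} (hk : k ≤ m) (c : Fin n → ℂ) :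
    fundamentalWeight k c
      = ∑ i : Fin m, c (fstHalf hm i) * ((if (i : ℕ) < k then 1 else 0 : ℤ) : ℂ) := by
  symm
  refine Finset.sum_of_injOn (fstHalf hm) (fun i _ j _ h => (fstHalf_inj hm).mp h)
    (fun _ _ => Finset.mem_coe.mpr (Finset.mem_univ _)) (fun a _ ha => ?_) fun i _ => ?_
  · refine if_neg fun h => ha ⟨⟨a, by omega⟩, Finset.mem_coe.mpr (Finset.mem_univ _), rfl⟩
  · change _ = if (i : ℕ) < k then _ else _
    split_ifs <;> simp

/-- `-d_H(t_i t_{j+m})` has the weight `ε_i - ε_j`. -/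
lemma lie_cartan_short (k i j : Fin m) :
    ⁅diagonal (cartanCoeff hm k), -dH m (t (fstHalf hm i) * t (sndHalf hm j))⁆
      = (((Pi.single k 1 : Fin m → ℤ) i - (Pi.single k 1 : Fin m → ℤ) j : ℤ) : ℂ)
        • -dH m (t (fstHalf hm i) * t (sndHalf hm j)) := by
  rw [dH_fstHalf_sndHalf, witt_lie_sub, lie_diagonal, lie_diagonal]
  simp only [cartanCoeff_fstHalf, cartanCoeff_sndHalf]
  refine Derivation.ext fun f => ?_
  simp only [Derivation.sub_apply, Derivation.smul_apply]
  push_cast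
  module

/-- `d_H(t_i t_j)` has the weight `ε_i + ε_j`. -/
lemma lie_cartan_sum (k i j : Fin m) :
    ⁅diagonal (cartanCoeff hm k), dH m (t (fstHalf hm i) * t (fstHalf hm j))⁆
      = (((Pi.single k 1 : Fin m → ℤ) i + (Pi.single k 1 : Fin m → ℤ) j : ℤ) : ℂ)
        • dH m (t (fstHalf hm i) * t (fstHalf hm j)) := by
  rw [dH_fstHalf_fstHalf, witt_lie_add, lie_diagonal, lie_diagonal]
  simp only [cartanCoeff_fstHalf, cartanCoeff_sndHalf]
  refine Derivation.ext fun f => ?_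
  simp only [Derivation.add_apply, Derivation.smul_apply]
  push_cast
  module

/-- `d_H(t_{i+m}^2)` has the weight `-2 ε_i`. -/
lemma lie_cartan_neg (i : Fin m) :
    ⁅diagonal (cartanCoeff hm i), dH m (t (sndHalf hm i) * t (sndHalf hm i))⁆
      = (-2 : ℂ) • dH m (t (sndHalf hm i) * t (sndHalf hm i)) := by
  rw [dH_sndHalf_sndHalf, witt_lie_smul, lie_diagonal]
  simp only [cartanCoeff_fstHalf, cartanCoeff_sndHalf, Pi.single_eq_same]
  push_cast
  congr 2
  norm_num

/-- The root vectors `t_i d_{i+m}` and `t_{i+m} d_i` of `±2 ε_i` have the bracket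
`t_i d_i - t_{i+m} d_{i+m}`. -/
lemma lie_long (i : Fin m) :
    ⁅(1 / 2 : ℂ) • dH m (t (fstHalf hm i) * t (fstHalf hm i)),
      (-1 / 2 : ℂ) • dH m (t (sndHalf hm i) * t (sndHalf hm i))⁆ = diagonal (cartanCoeff hm i) := by
  rw [dH_fstHalf_fstHalf, dH_sndHalf_sndHalf, cartanCoeff, diagonal_single_sub, ← two_smul ℂ,
    smul_smul, smul_smul, witt_smul_lie, witt_lie_smul, lie_t_smul_d, if_pos rfl, if_pos rfl,
    smul_smul]
  refine (congrArg (· • _) ?_).trans (one_smul ℂ _)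
  norm_num

/-- The bracket of the root vectors of `ε_i - ε_j` and `ε_j - ε_i` is the difference of the diagonal
fields of `i` and `j`. -/
lemma lie_short_short (i j : Fin m) :
    ⁅-dH m (t (fstHalf hm i) * t (sndHalf hm j)), -dH m (t (fstHalf hm j) * t (sndHalf hm i))⁆
      = diagonal (cartanCoeff hm i) - diagonal (cartanCoeff hm j) := by
  simp only [dH_fstHalf_sndHalf, cartanCoeff, diagonal_single_sub, witt_lie_sub, witt_sub_lie,
    lie_t_smul_d, fstHalf_ne_sndHalf, sndHalf_ne_fstHalf, if_true, if_false]
  abel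

/-- An irreducible module killed by `𝔤` and the `K_j` is exceptional if each `d_H(t_a²)` acts with
square zero. -/
lemma exists_isExceptional_H (hirr : LieModule.IsIrreducible ℂ (degZero g (.H m hm : Series n)) V)
    (hcur : ∀ y : degZero g (.H m hm : Series n), (y : Toroidal g (.H m hm : Series n)).right = 0 →
      ∀ v : V, ⁅y, v⁆ = 0)
    (hsq : ∀ a : Fin n, fieldAct g V (fieldH hm a a) * fieldAct g V (fieldH hm a a) = 0) :
    ∃ k ≤ m, IsExceptional g (.H m hm : Series n) k V := by
  have := LieModule.nontrivial_of_isIrreducible ℂ (degZero g (.H m hm : Series n)) V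
  set H : Fin m → Module.End ℂ V := fun k => fieldAct g V (cartanH hm k) with hH
  -- the short roots `ε_i - ε_j`
  have hshort : ∀ k i j, H k * fieldAct g V (-fieldH hm (fstHalf hm i) (sndHalf hm j))
      - fieldAct g V (-fieldH hm (fstHalf hm i) (sndHalf hm j)) * H k
      = (((Pi.single k 1 : Fin m → ℤ) i - (Pi.single k 1 : Fin m → ℤ) j : ℤ) : ℂ)
        • fieldAct g V (-fieldH hm (fstHalf hm i) (sndHalf hm j)) :=
    fun k i j => fieldAct_lie_smul (lie_cartan_short hm k i j)
  have hsum : ∀ k i j, H k * fieldAct g V (fieldH hm (fstHalf hm i) (fstHalf hm j))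
      - fieldAct g V (fieldH hm (fstHalf hm i) (fstHalf hm j)) * H k
      = (((Pi.single k 1 : Fin m → ℤ) i + (Pi.single k 1 : Fin m → ℤ) j : ℤ) : ℂ)
        • fieldAct g V (fieldH hm (fstHalf hm i) (fstHalf hm j)) :=
    fun k i j => fieldAct_lie_smul (lie_cartan_sum hm k i j)
  have hneg : ∀ i, H i * fieldAct g V (fieldH hm (sndHalf hm i) (sndHalf hm i))
      - fieldAct g V (fieldH hm (sndHalf hm i) (sndHalf hm i)) * H i
      = (-2 : ℂ) • fieldAct g V (fieldH hm (sndHalf hm i) (sndHalf hm i)) :=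
    fun i => fieldAct_lie_smul (lie_cartan_neg hm i)
  set e : Fin m → Module.End ℂ V := fun i =>
    (1 / 2 : ℂ) • fieldAct g V (fieldH hm (fstHalf hm i) (fstHalf hm i)) with he
  set f : Fin m → Module.End ℂ V := fun i =>
    (-1 / 2 : ℂ) • fieldAct g V (fieldH hm (sndHalf hm i) (sndHalf hm i)) with hf
  have he2 : ∀ i, e i * e i = 0 := fun i => by
    simp only [he, smul_mul_smul_comm, hsq, smul_zero]
  have hf2 : ∀ i, f i * f i = 0 := fun i => by
    simp only [hf, smul_mul_smul_comm, hsq, smul_zero]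
  have hef : ∀ i, e i * f i - f i * e i = H i := by
    intro i
    simp only [he, hf, ← map_smul]
    exact fieldAct_lie (lie_long hm i)
  have hhe : ∀ i, H i * e i - e i * H i = (2 : ℂ) • e i := by
    intro i
    simp only [he, mul_smul_comm, smul_mul_assoc, ← smul_sub, hsum, Pi.single_eq_same]
    push_cast
    module
  have hhf : ∀ i, H i * f i - f i * H i = (-2 : ℂ) • f i := by
    intro i
    simp only [hf, mul_smul_comm, smul_mul_assoc, ← smul_sub, hneg]
    module
  have hcube : ∀ i, H i * H i * H i = H i := fun i =>
    sl2_cube (hef i) (by rw [hhe]; module) (by rw [hhf]; module) (he2 i) (hf2 i)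
  -- positive and strictly decreasing coefficients give all positive roots positive height
  obtain ⟨v, hv, l, hl, hmax⟩ := exists_highest H (fun i j => fieldAct_diagonal_comm _ _) hcube
    (fun i => (m : ℤ) - i)
  have hpos : ∀ i j, i < j → fieldAct g V (-fieldH hm (fstHalf hm i) (sndHalf hm j)) v = 0 := by
    intro i j hij
    refine hmax _ _ (fun k => hshort k i j) ?_
    simp only [mul_sub, Finset.sum_sub_distrib, Pi.single_apply, mul_ite, mul_one, mul_zero,
      Finset.sum_ite_eq, Finset.mem_univ, if_true]
    have : (i : ℕ) < j := hij
    omega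
  have hpos' : ∀ i j, fieldAct g V (fieldH hm (fstHalf hm i) (fstHalf hm j)) v = 0 := by
    intro i j
    refine hmax _ _ (fun k => hsum k i j) ?_
    simp only [mul_add, Finset.sum_add_distrib, Pi.single_apply, mul_ite, mul_one, mul_zero,
      Finset.sum_ite_eq, Finset.mem_univ, if_true]
    have := i.2
    have := j.2
    omega
  have h01 : ∀ i, l i = 0 ∨ l i = 1 := fun i =>
    sl2_highest_weight (hef i) (hhf i) (hf2 i) hv
      (by simp only [he, LinearMap.smul_apply, hpos', smul_zero]) (hl i)
  have hanti : ∀ i j, i < j → l j = 1 → l i = 1 := by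
    intro i j hij
    refine weight_eq_one (f := fieldAct g V (-fieldH hm (fstHalf hm j) (sndHalf hm i))) ?_ ?_
      (hcube j) hv (hpos i j hij) (hl i) (hl j)
    · rw [← fieldAct_sub]
      exact fieldAct_lie (lie_short_short hm i j)
    · rw [hshort]; simp [hij.ne]
  obtain ⟨k, hk, hlk⟩ := exists_threshold l h01 hanti
  refine ⟨k, hk, isExceptional_of_highest_weight hirr hcur hv ?_ fun D c hD => ?_⟩
  · rintro D ⟨i, j, i', j', hi', hj', h⟩
    have him : (i : ℕ) < m := by have := i'.2; omega
    have hjm : (j : ℕ) < m := by have := j'.2; omega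
    obtain rfl : i' = sndHalf hm ⟨i, him⟩ := Fin.ext hi'
    obtain rfl : j' = sndHalf hm ⟨j, hjm⟩ := Fin.ext hj'
    rcases h with ⟨hij, h⟩ | ⟨-, h⟩
    · have h1 : D = -fieldH hm (fstHalf hm ⟨i, him⟩) (sndHalf hm ⟨j, hjm⟩) :=
        Subtype.ext (h.trans (dH_fstHalf_sndHalf hm ⟨i, him⟩ ⟨j, hjm⟩).symm)
      rw [h1]; exact hpos _ _ hij
    · have h1 : D = fieldH hm (fstHalf hm ⟨i, him⟩) (fstHalf hm ⟨j, hjm⟩) :=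
        Subtype.ext (h.trans (dH_fstHalf_fstHalf hm ⟨i, him⟩ ⟨j, hjm⟩).symm)
      rw [h1]; exact hpos' _ _
  · have hmem := D.2.1
    rw [hD] at hmem
    have hc : (D : Witt n) = ∑ i, c (fstHalf hm i) • (cartanH hm i : Witt n) := by
      change _ = ∑ i, c (fstHalf hm i) • diagonal (cartanCoeff hm i)
      rw [hD, ← diagonal_sum]
      congr 1
      funext a
      rcases exists_half hm a with ⟨b, rfl⟩ | ⟨b, rfl⟩
      · simp [cartanCoeff_fstHalf, Pi.single_apply]
      · simp [cartanCoeff_sndHalf, Pi.single_apply, coeff_of_diagonal_mem hm hmem b]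
    rw [fieldAct_sum_apply hl hc, fundamentalWeight_eq hm hk]
    simp only [hlk]

end SeriesH

/-! ### Subspaces stable under the toroidal algebra -/

namespace ToroidalModule

section SquaresW

variable {n : ℕ} {g : Type*} [LieRing g] [LieAlgebra ℂ g]
  {M : Type*} [AddCommGroup M] [Module ℂ M] [Module (Poly n) M] [IsScalarTower ℂ (Poly n) M]

lemma sub_sq_mem_core_W (T : ToroidalModule g M (.W : Series n)) {N : Submodule ℂ M}
    (hN : T.IsRhoSubmodule N) (i : Fin n) {v : M} (hv : v ∈ N) :
    T.σ₀ (degZeroField g _ (fieldW i i)) v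
      - T.σ₀ (degZeroField g _ (fieldW i i)) (T.σ₀ (degZeroField g _ (fieldW i i)) v)
        ∈ core (n := n) N :=
  sub_sq_mem_core_of_first_order (R := fun f => T.ρ (ofField g (f • d i) (LieSubalgebra.mem_top _)))
    (p := T.partialOp i) (S := fun a => T.σ (linW g a i)) (fun f v => T.compat f i v)
    (T.partialOp_smul i) (fun _ => T.σ_smul _) (fun _ _ hv => hN _ _ hv) hv

lemma sq_mem_core_linS (T : ToroidalModule g M (.S : Series n)) {N : Submodule ℂ M}
    (hN : T.IsRhoSubmodule N) {i j : Fin n} (hij : i < j) (a : Fin n) {v : M} (hv : v ∈ N) :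
    T.σ (linS g i j a a) (T.σ (linS g i j a a) v) ∈ core (n := n) N := by
  refine sq_mem_core_of_second_order
    (R := fun f => T.ρ (ofField g (dS i j f) (dS_mem i j f))) (P := T.partialOp)
    (J := fun a b => (if a = j ∧ b = i then 1 else 0) - if a = i ∧ b = j then 1 else 0)
    (S := fun a b => T.σ (linS g i j a b)) (fun f v => ?_) T.partialOp_smul
    (fun _ _ => T.σ_smul _) (fun a b => by simp only [linS, mul_comm]) (fun _ _ hv => hN _ _ hv)
    ?_ hv
  · rw [T.compat f i j v hij]
    congr 1
    have h : ∀ a b,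
        (((if a = j ∧ b = i then 1 else 0) - if a = i ∧ b = j then 1 else 0 : ℂ) • d a f) •
            T.partialOp b v
          = (if a = j then if b = i then d j f • T.partialOp i v else 0 else 0)
          - if a = i then if b = j then d i f • T.partialOp j v else 0 else 0 := by
      intro a b
      by_cases h1 : a = j <;> by_cases h2 : b = i <;> by_cases h3 : a = i <;> by_cases h4 : b = j
      all_goals first
        | exact absurd (h3.symm.trans h1) hij.ne
        | exact absurd (h2.symm.trans h4) hij.ne
        | simp [h1, h2, h3, h4, hij.ne, hij.ne']
    simp only [h, Finset.sum_sub_distrib]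
    simp [partialOp]
  · have h1 : ¬ (a = j ∧ a = i) := fun h => hij.ne (h.2.symm.trans h.1)
    have h2 : ¬ (a = i ∧ a = j) := fun h => hij.ne (h.1.symm.trans h.2)
    simp [h1, h2]

lemma sq_mem_core_S (T : ToroidalModule g M (.S : Series n)) {N : Submodule ℂ M}
    (hN : T.IsRhoSubmodule N) {i j : Fin n} (h : i ≠ j) {v : M} (hv : v ∈ N) :
    T.σ₀ (degZeroField g _ (fieldS h)) (T.σ₀ (degZeroField g _ (fieldS h)) v)
      ∈ core (n := n) N := by
  obtain ⟨c, y, hy, hyv⟩ : ∃ (c : ℂ) (y : geZero g (.S : Series n)),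
      T.σ₀ (degZeroField g _ (fieldS h)) = c • T.σ y ∧ T.σ y (T.σ y v) ∈ core (n := n) N := by
    rcases lt_or_gt_of_ne h with h1 | h1
    · have h2 : fieldS h = (-1 / 2 : ℂ) • ⟨dS i j (t i * t i), dS_mem i j _, linear_S i j i i⟩ :=
        Subtype.ext (t_smul_d_eq_dS h)
      exact ⟨_, linS g i j i i, by rw [h2, map_smul, map_smul]; rfl,
        T.sq_mem_core_linS hN h1 i hv⟩
    · have h2 : fieldS h = (1 / 2 : ℂ) • ⟨dS j i (t i * t i), dS_mem j i _, linear_S j i i i⟩ :=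
        Subtype.ext ((t_smul_d_eq_dS h).trans (by
          change (-1 / 2 : ℂ) • dS i j (t i * t i) = (1 / 2 : ℂ) • dS j i (t i * t i)
          rw [dS_swap i j]
          refine Derivation.ext fun f => ?_
          simp only [Derivation.neg_apply, Derivation.smul_apply]
          module))
      exact ⟨_, linS g j i i i, by rw [h2, map_smul, map_smul]; rfl,
        T.sq_mem_core_linS hN h1 i hv⟩
  rw [hy, LinearMap.smul_apply, LinearMap.smul_apply, map_smul]
  exact Submodule.smul_of_tower_mem _ _ (Submodule.smul_of_tower_mem _ _ hyv)

lemma sq_mem_core_H {m : ℕ} {hm : n = 2 * m} (T : ToroidalModule g M (.H m hm : Series n))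
    {N : Submodule ℂ M} (hN : T.IsRhoSubmodule N) (a : Fin n) {v : M} (hv : v ∈ N) :
    T.σ (linH g m hm a a) (T.σ (linH g m hm a a) v) ∈ core (n := n) N := by
  refine sq_mem_core_of_second_order
    (R := fun f => T.ρ (ofField g (dH m f) (dH_mem hm f))) (P := T.partialOp) (J := sympl m)
    (S := fun a b => T.σ (linH g m hm a b)) (fun f v => T.compat f v) T.partialOp_smul
    (fun _ _ => T.σ_smul _) (fun a b => by simp only [linH, mul_comm]) (fun _ _ hv => hN _ _ hv)
    ?_ hv
  -- `n = 2m` is positive, so the two alternatives in `sympl m a a` are void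
  have h1 : m ≠ 0 := by have := a.2; omega
  simp [sympl, h1]

end SquaresW

variable {n : ℕ} {g : Type*} [LieRing g] [LieAlgebra ℂ g]
  {M : Type*} [AddCommGroup M] [Module ℂ M] [Module (Poly n) M] {X : Series n}

variable [IsScalarTower ℂ (Poly n) M]

/-- Unless the subspace `N`, stable under `ρ`, is an `A_n`-submodule, some irreducible
constituent of `M` is killed by `𝔤`, by the `K_j`, and by all `A_n`-linear operators that map
`N` to its core. -/
lemma exists_annihilated_constituent (T : ToroidalModule g M X)
    (hcr : ComplementedLattice (LieSubmodule ℂ (degZero g X) (RepSpace T.σ₀)))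
    {N : Submodule ℂ M} (hN : T.IsRhoSubmodule N) (hcon : ¬ ∀ v ∈ N, v ∈ core (n := n) N) :
    ∃ V : LieSubmodule ℂ (degZero g X) (RepSpace T.σ₀), LieModule.IsIrreducible ℂ (degZero g X) V ∧
      (∀ y : degZero g X, (y : Toroidal g X).right = 0 → ∀ v : V, ⁅y, v⁆ = 0) ∧
      ∀ q : Module.End ℂ M, (∀ (f : Poly n) v, q (f • v) = f • q v) →
        (∀ v ∈ N, q v ∈ core (n := n) N) → ∀ w w' : V, w'.1 = q w.1 → w' = 0 := by
  obtain ⟨V, hirr, hspan, hcore⟩ := T.exists_irreducible hcr hN hcon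
  have kill : ∀ q : Module.End ℂ M, (∀ (f : Poly n) v, q (f • v) = f • q v) →
      (∀ v ∈ N, q v ∈ core (n := n) N) → ∀ w w' : V, w'.1 = q w.1 → w' = 0 := by
    intro q hq hqN w w' hw
    have h1 : q w.1 ∈ core (n := n) N := mem_core_of_span hq hqN (hspan w.1 w.2)
    rw [← hw] at h1
    exact Subtype.ext (hcore _ w'.2 h1)
  exact ⟨V, hirr,
    fun y hy v => kill (T.σ₀ y) (T.σ₀_smul y) (fun _ hv => T.σ₀_mem_core hN hy hv) v _ rfl, kill⟩

lemma mem_core_W (T : ToroidalModule g M (.W : Series n))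
    (hcr : ComplementedLattice (LieSubmodule ℂ (degZero g (.W : Series n)) (RepSpace T.σ₀)))
    (hexc : ∀ N : LieSubmodule ℂ (degZero g (.W : Series n)) (RepSpace T.σ₀),
      ∀ k ≤ n, ¬ IsExceptional g (.W : Series n) k N)
    {N : Submodule ℂ M} (hN : T.IsRhoSubmodule N) : ∀ v ∈ N, v ∈ core (n := n) N := by
  by_contra hcon
  obtain ⟨V, hirr, hcur, kill⟩ := T.exists_annihilated_constituent hcr hN hcon
  obtain ⟨k, hk, h⟩ := exists_isExceptional_W hirr hcur fun i => by
    rw [eq_comm, ← sub_eq_zero]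
    refine LinearMap.ext fun w => ?_
    let E := T.σ₀ (degZeroField g _ (fieldW i i))
    exact kill (E - E * E) (fun f v => by
      simp only [E, LinearMap.sub_apply, Module.End.mul_apply, σ₀_smul, smul_sub])
      (fun v hv => T.sub_sq_mem_core_W hN i hv) w _ rfl
  exact hexc V k hk h

lemma mem_core_S (hn : 2 ≤ n) (T : ToroidalModule g M (.S : Series n))
    (hcr : ComplementedLattice (LieSubmodule ℂ (degZero g (.S : Series n)) (RepSpace T.σ₀)))
    (hexc : ∀ N : LieSubmodule ℂ (degZero g (.S : Series n)) (RepSpace T.σ₀),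
      ∀ k ≤ n - 1, ¬ IsExceptional g (.S : Series n) k N)
    {N : Submodule ℂ M} (hN : T.IsRhoSubmodule N) : ∀ v ∈ N, v ∈ core (n := n) N := by
  by_contra hcon
  obtain ⟨V, hirr, hcur, kill⟩ := T.exists_annihilated_constituent hcr hN hcon
  obtain ⟨k, hk, h⟩ := exists_isExceptional_S hn hirr hcur fun i j h => by
    refine LinearMap.ext fun w => ?_
    let E := T.σ₀ (degZeroField g _ (fieldS h))
    exact kill (E * E) (fun f v => by simp only [E, Module.End.mul_apply, σ₀_smul])
      (fun v hv => T.sq_mem_core_S hN h hv) w _ rfl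
  exact hexc V k hk h

lemma mem_core_H {m : ℕ} {hm : n = 2 * m} (T : ToroidalModule g M (.H m hm : Series n))
    (hcr : ComplementedLattice (LieSubmodule ℂ (degZero g (.H m hm)) (RepSpace T.σ₀)))
    (hexc : ∀ N : LieSubmodule ℂ (degZero g (.H m hm)) (RepSpace T.σ₀),
      ∀ k ≤ m, ¬ IsExceptional g (.H m hm : Series n) k N)
    {N : Submodule ℂ M} (hN : T.IsRhoSubmodule N) : ∀ v ∈ N, v ∈ core (n := n) N := by
  by_contra hcon
  obtain ⟨V, hirr, hcur, kill⟩ := T.exists_annihilated_constituent hcr hN hcon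
  obtain ⟨k, hk, h⟩ := exists_isExceptional_H hm hirr hcur fun a => by
    refine LinearMap.ext fun w => ?_
    let E := T.σ₀ (degZeroField g _ (fieldH hm a a))
    exact kill (E * E) (fun f v => by simp only [E, Module.End.mul_apply, σ₀_smul])
      (fun v hv => T.sq_mem_core_H hN a hv) w _ rfl
  exact hexc V k hk h

/-- The subspaces stable under `ρ` are `A_n`-submodules, since otherwise `M` has an exceptional
constituent. -/
lemma mem_core (hn : 2 ≤ n) (T : ToroidalModule g M X)
    (hcr : ComplementedLattice (LieSubmodule ℂ (degZero g X) (RepSpace T.σ₀)))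
    (hexc : ∀ N : LieSubmodule ℂ (degZero g X) (RepSpace T.σ₀),
      ∀ k ≤ rankX X, ¬ IsExceptional g X k N)
    {N : Submodule ℂ M} (hN : T.IsRhoSubmodule N) : ∀ v ∈ N, v ∈ core (n := n) N := by
  cases X with
  | W => exact T.mem_core_W hcr hexc hN
  | S => exact T.mem_core_S hn hcr hexc hN
  | H m hm => exact T.mem_core_H hcr hexc hN

end ToroidalModule

end PolyToroidal

end

theorem theorem4p7 {n : ℕ} (hn : 2 ≤ n) (X : PolyToroidal.Series n)
    {g : Type*} [LieRing g] [LieAlgebra ℂ g] [Module.Finite ℂ g] [LieAlgebra.IsSimple ℂ g]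
    {M : Type*} [AddCommGroup M] [Module ℂ M] [Module (PolyToroidal.Poly n) M]
    [IsScalarTower ℂ (PolyToroidal.Poly n) M]
    (T : PolyToroidal.ToroidalModule g M X)
    (hσ : ∀ y : PolyToroidal.geZero g X,
      (y : PolyToroidal.Toroidal g X) ∈ PolyToroidal.filtration g X 1 → T.σ y = 0)
    (hcr : ComplementedLattice
      (LieSubmodule ℂ (PolyToroidal.degZero g X) (PolyToroidal.RepSpace T.σ₀)))
    (hexc : ∀ N : LieSubmodule ℂ (PolyToroidal.degZero g X) (PolyToroidal.RepSpace T.σ₀),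
      ∀ k ≤ PolyToroidal.rankX X, ¬ PolyToroidal.IsExceptional g X k N)
    (M' : Submodule ℂ M) (hM' : T.IsRhoSubmodule M') :
    T.IsToroidalSubmodule M' := by
  have hcore := T.mem_core hn hcr hexc hM'
  exact ⟨fun f v hv => hcore v hv f, hM', fun y v hv =>
    PolyToroidal.core_le (T.σ_mem hσ (T.ρ_mem_core hM') y (hcore v hv))⟩
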